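/- For a finite poset $P$ with minimum $\hat 0$, maximum $\hat 1$ and a rank function (with $\mathrm{rank}(\hat 0)=0$, increasing by one along coverings) call $P$ graded of rank $n=\mathrm{rank}(\hat 1)\ge 1$, and for $S\subseteq\{1,\dots,n-1\}$ let $f_S(P)$ be the number of chains of $P$ whose set of ranks is $S$. For $n\ge1$ let $A_n$ be the real vector space with basis the chain operators $f^n_S$, $S\subseteq\{1,\dots,n-1\}$, where $f^n_S$ takes the value $f_S(P)$ on graded posets $P$ of rank $n$ and the value $0$ on all other graded posets; put $A_0=\mathbb R$. The space $A=\bigoplus_{n\ge0}A_n$ is a graded ring under Kalai's convolution $f^m_S\ast f^n_T=f^{m+n}_{S\cup\{m\}\cup(T+m)}$ $(m,n\ge1)$, with unit $1\in A_0$. Let $K_n\subseteq A_n$ be the cone of the forms that are nonnegative on all graded posets of rank $n$, and $K_0=A_0$. An element $F\ne0$ of a cone $K$ is called an extreme ray of $K$ if, whenever $F=G+H$ with $G,H\in K$, both $G$ and $H$ are nonnegative multiples of $F$. A form $F \in A_n$, $n\ge 1$, $F\neq 0$, is called indecomposable if it is not a product of two homogeneous forms of lower degree. **Theorem 5.1.**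 (a) Let $F\in K_m$ and $G\in K_n$ be extreme rays of their respective cones. Then $F\ast G\in K_{m+n}$, and $F\ast G$ is an extreme ray of $K_{m+n}$ if and only if it is not the case that $F=F'\ast f^k_\emptyset$ and $G=f^l_\emptyset\ast G'$ for some $1\le k\le m$, $1\le l\le n$, $F'\in K_{m-k}$ and $G'\in K_{n-l}$. (b) Let $r\ge1$ and let $F_i\in K_{n_i}$ $(1\le i\le r)$ be indecomposable forms. Then $F_1\ast\cdots\ast F_r$ is an extreme ray of $K_{n_1+\cdots+n_r}$ if and only if every $F_i$ is an extreme ray of $K_{n_i}$ and there is no $i<r$ such that $F_i$ and $F_{i+1}$ are scalar multiples of $f^{n_i}_\emptyset$ and $f^{n_{i+1}}_\emptyset$, respectively. -/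

import Mathlib

noncomputable section

namespace FlagPoset

/-- The symbol of the chain operator `f_S^n`: a rank `n` and a set `S ⊆ {1, …, n-1}`. -/
@[ext]
structure ChainOp where
  rank : ℕ
  set : Finset ℕ
  set_subset : set ⊆ Finset.Ioo 0 rank

namespace ChainOp

/-- The chain operator of rank `n` with `S = ∅`; for `n = 0` it is the only symbol of rank `0`. -/
def empty (n : ℕ) : ChainOp := ⟨n, ∅, Finset.empty_subset _⟩

/-- The set of ranks of the convolution: `S ∪ {m} ∪ (T + m)` for `m, n ≥ 1`; the symbol of
rank `0` is neutral. -/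
def convSet (m : ℕ) (S : Finset ℕ) (n : ℕ) (T : Finset ℕ) : Finset ℕ :=
  if m = 0 then T else if n = 0 then S else S ∪ {m} ∪ T.image (fun t => t + m)

theorem mem_convSet {m n : ℕ} {S T : Finset ℕ} (i : ℕ) (hS : S ⊆ Finset.Ioo 0 m)
    (hT : T ⊆ Finset.Ioo 0 n) :
    i ∈ convSet m S n T ↔ i ∈ S ∨ (i = m ∧ 0 < m ∧ 0 < n) ∨ ∃ t ∈ T, t + m = i := by
  unfold convSet
  rcases Nat.eq_zero_or_pos m with rfl | hm
  · have : S = ∅ := by simpa using hS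
    simp [this]
  rcases Nat.eq_zero_or_pos n with rfl | hn
  · have : T = ∅ := by simpa using hT
    simp [this, hm.ne']
  simp [hm.ne', hn.ne', hm, hn]
  tauto

/-- `f_S^m ∗ f_T^n = f_{S ∪ {m} ∪ (T+m)}^{m+n}` for `m, n ≥ 1`, and the symbol of rank `0`
is the unit. -/
instance : Mul ChainOp where
  mul p q :=
    ⟨p.rank + q.rank, convSet p.rank p.set q.rank q.set, by
      intro i hi
      rw [mem_convSet i p.set_subset q.set_subset] at hi
      rw [Finset.mem_Ioo]
      rcases hi with h | ⟨rfl, h1, h2⟩ | ⟨t, ht, rfl⟩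
      · have := Finset.mem_Ioo.1 (p.set_subset h)
        omega
      · omega
      · have := Finset.mem_Ioo.1 (q.set_subset ht)
        omega⟩

instance : One ChainOp := ⟨empty 0⟩

theorem mul_rank (p q : ChainOp) : (p * q).rank = p.rank + q.rank := rfl

theorem mem_mul_set (p q : ChainOp) (i : ℕ) : i ∈ (p * q).set ↔
    i ∈ p.set ∨ (i = p.rank ∧ 0 < p.rank ∧ 0 < q.rank) ∨ ∃ t ∈ q.set, t + p.rank = i :=
  mem_convSet i p.set_subset q.set_subset

instance : Monoid ChainOp where
  mul_assoc p q r := by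
    ext i
    · simp only [mul_rank, add_assoc]
    · simp only [mem_mul_set, mul_rank]
      constructor
      · rintro ((h | h | ⟨t, ht, rfl⟩) | ⟨rfl, h1, h2⟩ | ⟨t, ht, rfl⟩)
        · exact Or.inl h
        · exact Or.inr (Or.inl (by omega))
        · exact Or.inr (Or.inr ⟨t, Or.inl ht, rfl⟩)
        · rcases Nat.eq_zero_or_pos q.rank with h0 | h0
          · exact Or.inr (Or.inl (by omega))
          · exact Or.inr (Or.inr ⟨q.rank, Or.inr (Or.inl ⟨rfl, h0, h2⟩), by omega⟩)
        · exact Or.inr (Or.inr ⟨t + q.rank, Or.inr (Or.inr ⟨t, ht, rfl⟩), by omega⟩)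
      · rintro (h | ⟨rfl, h1, h2⟩ | ⟨t, ht | ⟨rfl, h1, h2⟩ | ⟨s, hs, rfl⟩, rfl⟩)
        · exact Or.inl (Or.inl h)
        · rcases Nat.eq_zero_or_pos q.rank with h0 | h0
          · exact Or.inr (Or.inl (by omega))
          · exact Or.inl (Or.inr (Or.inl ⟨rfl, h1, h0⟩))
        · exact Or.inl (Or.inr (Or.inr ⟨t, ht, rfl⟩))
        · exact Or.inr (Or.inl (by omega))
        · exact Or.inr (Or.inr ⟨s, hs, by omega⟩)
  one_mul p := by
    have hr : (1 : ChainOp).rank = 0 := rfl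
    have hs : (1 : ChainOp).set = ∅ := rfl
    ext i
    · simp [mul_rank, hr]
    · simp [mem_mul_set, hr, hs]
  mul_one p := by
    have hr : (1 : ChainOp).rank = 0 := rfl
    have hs : (1 : ChainOp).set = ∅ := rfl
    ext i
    · simp [mul_rank, hr]
    · simp [mem_mul_set, hr, hs]

end ChainOp

/-- The graded ring of chain operators `A = ⨁ₙ Aₙ`: finite formal real linear combinations of
the `f_S^n`, multiplied by bilinear extension of the convolution. -/
abbrev FlagRing : Type := MonoidAlgebra ℝ ChainOp

/-- The chain operator `f_S^n` as an element of the ring. -/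
def chainOp (p : ChainOp) : FlagRing := MonoidAlgebra.single p 1

/-- The chain operator `f_∅^n`. -/
def fEmpty (n : ℕ) : FlagRing := chainOp (ChainOp.empty n)

/-- `Aₙ`, the space of forms of degree `n`: the span of the `f_S^n`, `S ⊆ {1, …, n-1}`. -/
def forms (n : ℕ) : Submodule ℝ FlagRing :=
  Submodule.span ℝ {F | ∃ p : ChainOp, p.rank = n ∧ F = chainOp p}

section Posets

variable (P : Type) [PartialOrder P] [BoundedOrder P] [GradeMinOrder ℕ P]

/-- The flag number `f_S(P)`: the number of chains of `P` whose set of ranks is `S`. (Since the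
rank function is strictly monotone, such a chain has one element of each rank in `S`.) -/
def flagNumber (S : Finset ℕ) : ℕ :=
  Nat.card {C : Finset P // IsChain (· ≤ ·) (C : Set P) ∧ C.image (grade ℕ) = S}

/-- The value of a linear combination of chain operators on the graded poset `P`; `f_S^n` takes
the value `f_S(P)` if `P` has rank `n`, and `0` otherwise. -/
def evalAt : FlagRing →ₗ[ℝ] ℝ :=
  (Finsupp.linearCombination ℝ fun p : ChainOp =>
      if grade ℕ (⊤ : P) = p.rank then (flagNumber P p.set : ℝ) else 0) ∘ₗ
    (MonoidAlgebra.coeffLinearEquiv ℝ).toLinearMap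

end Posets

/-- `Kₙ`: the forms of degree `n` that are nonnegative on all graded posets. A graded poset is a
finite poset with minimum `⊥`, maximum `⊤` and a rank function to `ℕ` that vanishes at `⊥` and
goes up by one along every covering; its rank, the rank of `⊤`, is at least one. -/
def cone (n : ℕ) : Set FlagRing :=
  {F | F ∈ forms n ∧ ∀ (P : Type) [Finite P] [PartialOrder P] [BoundedOrder P]
    [GradeMinOrder ℕ P], 1 ≤ grade ℕ (⊤ : P) → 0 ≤ evalAt P F}

/-- `F` spans an extreme ray of the convex cone `C`: it is a nonzero element of `C`, and whenever
it is a sum of two elements of `C`, both are nonnegative multiples of `F`. -/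
def IsExtremeRay {V : Type*} [AddCommGroup V] [Module ℝ V] (C : Set V) (F : V) : Prop :=
  F ∈ C ∧ F ≠ 0 ∧ ∀ G ∈ C, ∀ H ∈ C, F = G + H →
    (∃ t : ℝ, 0 ≤ t ∧ G = t • F) ∧ (∃ t : ℝ, 0 ≤ t ∧ H = t • F)

/-- A nonzero form of positive degree `n` that is not a product of two homogeneous forms of
lower degree. -/
def IsIndecomposable (n : ℕ) (F : FlagRing) : Prop :=
  0 < n ∧ F ∈ forms n ∧ F ≠ 0 ∧
    ∀ i < n, ∀ j < n, ∀ G ∈ forms i, ∀ H ∈ forms j, F ≠ G * H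

end FlagPoset

end

/-! For n ≥ 1 the cone `cone n` is polyhedral, with inequalities indexed by systems I of open
intervals of ranks. A form ∑ a_S f_S is nonnegative on all graded posets if and only if, for every
I, the sum of a_S over the sets S meeting every interval of I is nonnegative
(`cone_eq_nonnegForms`).

Sufficiency: number the elements of P and represent each chain by the lexicographically first
maximal chain through it. A maximal chain c is first through its elements with ranks in S exactly
when S meets every interval of ranks in which c can be improved. So f_S(P) counts the maximal chains
whose system is met by S (`flagNumber_eq_card`), and the value of the form at P is a sum of block
functionals, one per maximal chain. Necessity: the poset `IntervalPoset`, with N + 1 labels per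
interval, has f_S equal to (N + 1) to the number of intervals met by S. Dividing by (N + 1)^|I| and
letting N grow isolates the block functional of I.

Extremality thus becomes linear algebra: F is extreme if and only if every form vanishing on the
block functionals that kill F is a multiple of F. Block functionals are multiplicative along
convolution, because intervals around the splitting rank m are met automatically. This puts products
in the cone. Now let H vanish wherever F * G does, and split H into the part whose sets contain m
and the part whose sets avoid it. Each part is linear in the systems below and above m separately,
so it is proportional to the product of the values of F and G (`exists_eq_mul_of_vanish`). If the
part avoiding m is nonzero, intervals straddling m show that zeros of F persist when an interval (j,
m) is added, and symmetrically for G. All sets in the support of F then have the same maximum and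
those of G the same minimum, so both are divisible by some f_∅ on the inner side. Otherwise H is a
multiple of F * G (`eq_smul_mul_of_vanish`). Conversely, f_∅^k * f_∅^l - f_∅^(k+l) is nonnegative,
which splits the excluded products.

Part (b) is an induction on the number of factors: extremality passes to factors by cancellation,
and an indecomposable form divisible by f_∅ is a multiple of f_∅. -/

noncomputable section

namespace FlagPoset

/-! ### Linear extension and block functionals -/

section LinExt

variable {V : Type*} [AddCommGroup V] [Module ℝ V]

/-- The linear map on `FlagRing` with prescribed values on the chain operators. -/
def linExt (f : ChainOp → V) : FlagRing →ₗ[ℝ] V :=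
  Finsupp.linearCombination ℝ f ∘ₗ (MonoidAlgebra.coeffLinearEquiv ℝ).toLinearMap

@[simp]
theorem linExt_chainOp (f : ChainOp → V) (p : ChainOp) : linExt f (chainOp p) = f p := by
  simp [linExt, chainOp]

theorem linExt_apply (f : ChainOp → V) (F : FlagRing) :
    linExt f F = ∑ p ∈ F.coeff.support, F.coeff p • f p := by
  simp [linExt, Finsupp.linearCombination_apply, Finsupp.sum]

theorem linExt_congr {f g : ChainOp → V} {F : FlagRing}
    (h : ∀ p ∈ F.coeff.support, f p = g p) : linExt f F = linExt g F := by
  rw [linExt_apply, linExt_apply]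
  exact Finset.sum_congr rfl fun p hp => by rw [h p hp]

theorem hom_ext_chainOp {f g : FlagRing →ₗ[ℝ] V} (h : ∀ p, f (chainOp p) = g (chainOp p)) :
    f = g := by
  apply LinearMap.ext
  intro F
  have hF : F = ∑ p ∈ F.coeff.support, F.coeff p • chainOp p := by
    rw [← MonoidAlgebra.coeff_inj]
    conv_lhs => rw [← Finsupp.sum_single F.coeff]
    simp [chainOp, Finsupp.sum]
  rw [hF]
  simp [h]

theorem linExt_chainOp_self (F : FlagRing) : linExt chainOp F = F := by
  have : linExt chainOp = LinearMap.id := hom_ext_chainOp fun p => by simp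
  rw [this]; rfl

theorem linExt_mem (W : Submodule ℝ V) {f : ChainOp → V} (h : ∀ p, f p ∈ W) (F : FlagRing) :
    linExt f F ∈ W := by
  rw [linExt_apply]
  exact W.sum_mem fun p _ => W.smul_mem _ (h p)

end LinExt

theorem chainOp_mul (p q : ChainOp) : chainOp p * chainOp q = chainOp (p * q) := by
  simp [chainOp, MonoidAlgebra.single_mul_single]

theorem chainOp_mem_forms {n : ℕ} {p : ChainOp} (h : p.rank = n) : chainOp p ∈ forms n :=
  Submodule.subset_span ⟨p, h, rfl⟩

-- The linear map killing the symbols of rank n and fixing the others vanishes on the span, hence on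
-- F; its coefficients are those of F at the other ranks.
open Classical in
theorem mem_forms_iff {n : ℕ} {F : FlagRing} :
    F ∈ forms n ↔ ∀ p ∈ F.coeff.support, p.rank = n := by
  constructor
  · intro h
    have h0 : linExt (fun p => if p.rank = n then 0 else chainOp p) F =
        (0 : FlagRing →ₗ[ℝ] FlagRing) F := by
      refine LinearMap.eqOn_span ?_ h
      rintro _ ⟨p, hp, rfl⟩
      simp [hp]
    intro p hp
    by_contra hne
    have h1 : linExt (fun q => if q = p then (1 : ℝ) else 0)
        (linExt (fun p => if p.rank = n then 0 else chainOp p) F) = 0 := by rw [h0]; simp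
    have h2 : linExt (fun q => if q = p then (1 : ℝ) else 0) ∘ₗ
        linExt (fun p => if p.rank = n then 0 else chainOp p) =
        linExt (fun q => if q = p then (1 : ℝ) else 0) := by
      apply hom_ext_chainOp
      intro q
      by_cases hq : q.rank = n
      · have : q ≠ p := by rintro rfl; exact hne hq
        simp [hq, this]
      · simp [hq]
    have h3 := LinearMap.congr_fun h2 F
    rw [LinearMap.comp_apply, h1, linExt_apply] at h3
    simp at h3 hp
    exact hp (h3 hp).symm
  · intro h
    rw [← linExt_chainOp_self F, linExt_apply]
    refine Submodule.sum_mem _ fun p hp => Submodule.smul_mem _ _ ?_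
    exact chainOp_mem_forms (h p hp)

theorem mul_mem_forms {m n : ℕ} {F G : FlagRing} (hF : F ∈ forms m) (hG : G ∈ forms n) :
    F * G ∈ forms (m + n) := by
  rw [mem_forms_iff] at *
  intro p hp
  classical
  obtain ⟨q, hq, r, hr, rfl⟩ := Finset.mem_mul.1 (MonoidAlgebra.support_coeff_mul_subset _ _ hp)
  rw [ChainOp.mul_rank, hF q hq, hG r hr]

/-- Two bilinear expressions agree on homogeneous forms if they agree on chain operators. -/
theorem bilin_eq_of_chainOp {V : Type*} [AddCommGroup V] [Module ℝ V] {m n : ℕ}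
    {f g : FlagRing →ₗ[ℝ] FlagRing →ₗ[ℝ] V}
    (h : ∀ p q : ChainOp, p.rank = m → q.rank = n →
      f (chainOp p) (chainOp q) = g (chainOp p) (chainOp q))
    {F G : FlagRing} (hF : F ∈ forms m) (hG : G ∈ forms n) : f F G = g F G := by
  refine LinearMap.eqOn_span (f := f F) (g := g F) ?_ hG
  rintro _ ⟨q, hq, rfl⟩
  refine LinearMap.eqOn_span (f := f.flip (chainOp q)) (g := g.flip (chainOp q)) ?_ hF
  rintro _ ⟨p, hp, rfl⟩
  exact h p q hp hq

open Classical in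
/-- The sum of the coefficients of all symbols whose set satisfies `Q`. -/
def condEval (Q : Finset ℕ → Prop) : FlagRing →ₗ[ℝ] ℝ :=
  linExt fun p => if Q p.set then 1 else 0

theorem condEval_chainOp_of {Q : Finset ℕ → Prop} {p : ChainOp} (h : Q p.set) :
    condEval Q (chainOp p) = 1 := by
  rw [condEval, linExt_chainOp, if_pos h]

theorem condEval_chainOp_of_not {Q : Finset ℕ → Prop} {p : ChainOp} (h : ¬ Q p.set) :
    condEval Q (chainOp p) = 0 := by
  rw [condEval, linExt_chainOp, if_neg h]

theorem condEval_chainOp_eq {Q Q' : Finset ℕ → Prop} {p q : ChainOp} (h : Q p.set ↔ Q' q.set) :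
    condEval Q (chainOp p) = condEval Q' (chainOp q) := by
  by_cases h' : Q p.set
  · rw [condEval_chainOp_of h', condEval_chainOp_of (h.1 h')]
  · rw [condEval_chainOp_of_not h', condEval_chainOp_of_not (fun h1 => h' (h.2 h1))]

theorem condEval_congr {n : ℕ} {Q Q' : Finset ℕ → Prop} {F : FlagRing} (hF : F ∈ forms n)
    (h : ∀ S ⊆ Finset.Ioo 0 n, (Q S ↔ Q' S)) : condEval Q F = condEval Q' F := by
  refine linExt_congr fun p hp => ?_
  have := h p.set (mem_forms_iff.1 hF p hp ▸ p.set_subset)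
  by_cases h : Q p.set <;> simp_all

theorem condEval_and_add (Q A : Finset ℕ → Prop) (F : FlagRing) :
    condEval (fun S => Q S ∧ A S) F + condEval (fun S => Q S ∧ ¬ A S) F = condEval Q F := by
  rw [← LinearMap.add_apply]
  refine LinearMap.congr_fun (hom_ext_chainOp fun p => ?_) F
  by_cases h : Q p.set <;> by_cases h' : A p.set <;> simp [condEval, h, h']

/-! ### Interval systems and multiplicativity of their functionals -/

/-- `S` meets every open interval `(i, j)` of the system `I`. -/
def Blocks (I : Finset (ℕ × ℕ)) (S : Finset ℕ) : Prop :=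
  ∀ q ∈ I, ∃ s ∈ S, q.1 < s ∧ s < q.2

/-- The systems of open intervals with endpoints in `{0, …, n}`. -/
def systems (n : ℕ) : Finset (Finset (ℕ × ℕ)) :=
  (Finset.range (n + 1) ×ˢ Finset.range (n + 1)).powerset

theorem mem_systems {n : ℕ} {I : Finset (ℕ × ℕ)} :
    I ∈ systems n ↔ ∀ q ∈ I, q.1 ≤ n ∧ q.2 ≤ n := by
  simp [systems, Finset.subset_iff]

theorem empty_mem_systems (n : ℕ) : ∅ ∈ systems n := by simp [mem_systems]

theorem union_mem_systems {n : ℕ} {I J : Finset (ℕ × ℕ)} (hI : I ∈ systems n)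
    (hJ : J ∈ systems n) : I ∪ J ∈ systems n := Finset.mem_powerset.2
  (Finset.union_subset (Finset.mem_powerset.1 hI) (Finset.mem_powerset.1 hJ))

theorem singleton_mem_systems {n i j : ℕ} (hi : i ≤ n) (hj : j ≤ n) : {(i, j)} ∈ systems n := by
  simp [mem_systems, hi, hj]

/-- The functional of the interval system `I`: the sum of the coefficients over the sets that
meet every interval of `I`. -/
def blockEval (I : Finset (ℕ × ℕ)) : FlagRing →ₗ[ℝ] ℝ := condEval (Blocks I)

theorem blocks_empty (S : Finset ℕ) : Blocks ∅ S := by simp [Blocks]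

theorem blocks_union {I J : Finset (ℕ × ℕ)} {S : Finset ℕ} :
    Blocks (I ∪ J) S ↔ Blocks I S ∧ Blocks J S := by
  simp only [Blocks, Finset.mem_union, or_imp, forall_and]

theorem blocks_singleton {i j : ℕ} {S : Finset ℕ} :
    Blocks {(i, j)} S ↔ ∃ s ∈ S, i < s ∧ s < j := by simp [Blocks]

/-- The translate of an interval system. -/
def shift (m : ℕ) (R : Finset (ℕ × ℕ)) : Finset (ℕ × ℕ) :=
  R.image fun q => (q.1 + m, q.2 + m)

theorem blocks_shift {m : ℕ} {R : Finset (ℕ × ℕ)} {S : Finset ℕ} :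
    Blocks (shift m R) S ↔ ∀ q ∈ R, ∃ s ∈ S, q.1 + m < s ∧ s < q.2 + m := by
  simp only [Blocks, shift, Finset.forall_mem_image]

theorem le_mem_systems {m n : ℕ} (h : m ≤ n) {I : Finset (ℕ × ℕ)} (hI : I ∈ systems m) :
    I ∈ systems n := by
  rw [mem_systems] at *
  exact fun q hq => ⟨(hI q hq).1.trans h, (hI q hq).2.trans h⟩

theorem shift_mem_systems {m n : ℕ} {R : Finset (ℕ × ℕ)} (hR : R ∈ systems n) :
    shift m R ∈ systems (m + n) := by
  rw [mem_systems] at *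
  simp only [shift, Finset.mem_image]
  rintro _ ⟨q, hq, rfl⟩
  have := hR q hq
  exact ⟨by dsimp; omega, by dsimp; omega⟩

/-- Endpoints in {0, …, m} leave only inner points strictly between 0 and m, so a system cannot see
whether m itself is in the set. -/
theorem blocks_low {m : ℕ} {L : Finset (ℕ × ℕ)} (hL : L ∈ systems m) {S T : Finset ℕ}
    (h : ∀ s, 0 < s → s < m → (s ∈ S ↔ s ∈ T)) : Blocks L S ↔ Blocks L T := by
  rw [mem_systems] at hL
  refine forall₂_congr fun q hq => exists_congr fun s => ?_
  have := hL q hq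
  constructor
  · rintro ⟨h1, h2, h3⟩
    exact ⟨(h s (by omega) (by omega)).1 h1, h2, h3⟩
  · rintro ⟨h1, h2, h3⟩
    exact ⟨(h s (by omega) (by omega)).2 h1, h2, h3⟩

theorem blocks_high {m n : ℕ} {R : Finset (ℕ × ℕ)} (hR : R ∈ systems n) {S T : Finset ℕ}
    (h : ∀ t, 0 < t → t < n → (t + m ∈ S ↔ t ∈ T)) : Blocks (shift m R) S ↔ Blocks R T := by
  rw [mem_systems] at hR
  rw [blocks_shift]
  refine forall₂_congr fun q hq => ?_
  have := hR q hq
  constructor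
  · rintro ⟨s, h1, h2, h3⟩
    refine ⟨s - m, (h _ (by omega) (by omega)).1 ?_, by omega, by omega⟩
    rwa [Nat.sub_add_cancel (by omega)]
  · rintro ⟨s, h1, h2, h3⟩
    exact ⟨s + m, (h s (by omega) (by omega)).2 h1, by omega, by omega⟩

/-- Both sides are bilinear, and on chain operators they are indicators, so the factorization of the
condition suffices. -/
theorem condEval_mul {m n : ℕ} {Q A B : Finset ℕ → Prop}
    (h : ∀ p q : ChainOp, p.rank = m → q.rank = n → (Q (p * q).set ↔ A p.set ∧ B q.set))
    {F G : FlagRing} (hF : F ∈ forms m) (hG : G ∈ forms n) :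
    condEval Q (F * G) = condEval A F * condEval B G := by
  refine bilin_eq_of_chainOp (f := (LinearMap.mul ℝ FlagRing).compr₂ (condEval Q))
    (g := (LinearMap.mul ℝ ℝ).compl₁₂ (condEval A) (condEval B)) (fun p q hp hq => ?_) hF hG
  have := h p q hp hq
  simp only [LinearMap.compr₂_apply, LinearMap.mul_apply', LinearMap.compl₁₂_apply, chainOp_mul,
    condEval, linExt_chainOp, this]
  by_cases A p.set <;> by_cases B q.set <;> simp [*]

theorem blocks_mul (p q : ChainOp) {L R : Finset (ℕ × ℕ)} (hL : L ∈ systems p.rank)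
    (hR : R ∈ systems q.rank) :
    Blocks (L ∪ shift p.rank R) (p * q).set ↔ Blocks L p.set ∧ Blocks R q.set := by
  rw [blocks_union]
  refine and_congr (blocks_low hL fun s h0 h1 => ?_) (blocks_high hR fun t h0 h1 => ?_)
  · rw [ChainOp.mem_mul_set]
    refine ⟨?_, Or.inl⟩
    rintro (h | h | ⟨t, _, h⟩)
    · exact h
    · omega
    · omega
  · rw [ChainOp.mem_mul_set]
    refine ⟨?_, fun h => Or.inr (Or.inr ⟨t, h, rfl⟩)⟩
    rintro (h | h | ⟨s, hs, h⟩)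
    · have := Finset.mem_Ioo.1 (p.set_subset h)
      omega
    · omega
    · obtain rfl : s = t := by omega
      exact hs

theorem blockEval_mul {m n : ℕ} {F G : FlagRing} (hF : F ∈ forms m) (hG : G ∈ forms n)
    {L R : Finset (ℕ × ℕ)} (hL : L ∈ systems m) (hR : R ∈ systems n) :
    blockEval (L ∪ shift m R) (F * G) = blockEval L F * blockEval R G := by
  refine condEval_mul (fun p q hp hq => ?_) hF hG
  subst hp hq
  exact blocks_mul p q hL hR

/-- Every set occurring in the product contains m, so an interval around m imposes no condition. -/
theorem blockEval_mul_straddle {m n i j : ℕ} {F G : FlagRing} (hF : F ∈ forms m)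
    (hG : G ∈ forms n) {L R : Finset (ℕ × ℕ)} (hL : L ∈ systems m) (hR : R ∈ systems n)
    (hm : 0 < m) (hn : 0 < n) (hi : i < m) (hj : m < j) :
    blockEval (L ∪ shift m R ∪ {(i, j)}) (F * G) = blockEval L F * blockEval R G := by
  refine condEval_mul (fun p q hp hq => ?_) hF hG
  subst hp hq
  rw [blocks_union, blocks_mul p q hL hR, and_iff_left]
  refine blocks_singleton.2 ⟨p.rank, ?_, hi, hj⟩
  rw [ChainOp.mem_mul_set]
  exact Or.inr (Or.inl ⟨rfl, hm, hn⟩)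

/-- Every interval system splits along a product, the intervals around the splitting point being
met automatically. -/
theorem exists_blockEval_mul_eq {m n : ℕ} {F G : FlagRing} (hF : F ∈ forms m)
    (hG : G ∈ forms n) {I : Finset (ℕ × ℕ)} (hI : I ∈ systems (m + n)) :
    ∃ L ∈ systems m, ∃ R ∈ systems n,
      blockEval I (F * G) = blockEval L F * blockEval R G := by
  rw [mem_systems] at hI
  -- The intervals in neither family satisfy i < m < j and are met at m. Empty intervals cause no
  -- harm: they are never met, before or after the splitting.
  refine ⟨I.filter fun q => q.1 ≤ m ∧ q.2 ≤ m, ?_,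
    (I.filter fun q => m ≤ q.1).image fun q => (q.1 - m, q.2 - m), ?_,
    condEval_mul (fun p q hp hq => ?_) hF hG⟩
  · simp only [mem_systems, Finset.mem_filter]
    exact fun q h => h.2
  · simp only [mem_systems, Finset.forall_mem_image, Finset.mem_filter]
    intro q h
    have := hI q h.1
    exact ⟨by omega, by omega⟩
  subst hp hq
  simp only [Blocks, Finset.forall_mem_image, Finset.mem_filter, and_imp]
  constructor
  · intro h
    refine ⟨fun x hx h1 h2 => ?_, fun x hx h1 => ?_⟩
    · obtain ⟨s, hs, h3, h4⟩ := h x hx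
      rw [ChainOp.mem_mul_set] at hs
      rcases hs with hs | hs | ⟨t, _, hs⟩
      · exact ⟨s, hs, h3, h4⟩
      · omega
      · omega
    · obtain ⟨s, hs, h3, h4⟩ := h x hx
      rw [ChainOp.mem_mul_set] at hs
      rcases hs with hs | hs | ⟨t, ht, hs⟩
      · have := Finset.mem_Ioo.1 (p.set_subset hs)
        omega
      · omega
      · exact ⟨t, ht, by omega, by omega⟩
  · rintro ⟨h1, h2⟩ x hx
    have hx' := hI x hx
    rcases le_or_gt p.rank x.1 with h | h
    · obtain ⟨t, ht, h3, h4⟩ := h2 hx h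
      refine ⟨t + p.rank, ?_, by omega, by omega⟩
      rw [ChainOp.mem_mul_set]
      exact Or.inr (Or.inr ⟨t, ht, rfl⟩)
    rcases le_or_gt x.2 p.rank with h' | h'
    · obtain ⟨s, hs, h3⟩ := h1 x hx h.le h'
      exact ⟨s, by rw [ChainOp.mem_mul_set]; exact Or.inl hs, h3⟩
    · refine ⟨p.rank, ?_, h, h'⟩
      rw [ChainOp.mem_mul_set]
      exact Or.inr (Or.inl ⟨rfl, by omega, by omega⟩)

/-! ### The polyhedral cone of the block functionals -/

/-- The forms of degree `n` on which all block functionals are nonnegative. -/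
def nonnegForms (n : ℕ) : Set FlagRing :=
  {F | F ∈ forms n ∧ ∀ I ∈ systems n, 0 ≤ blockEval I F}

theorem blockEval_apply (I : Finset (ℕ × ℕ)) (F : FlagRing) [DecidablePred (Blocks I)] :
    blockEval I F = ∑ p ∈ F.coeff.support, if Blocks I p.set then F.coeff p else 0 := by
  rw [blockEval, condEval, linExt_apply]
  refine Finset.sum_congr rfl fun p _ => ?_
  by_cases h : Blocks I p.set <;> simp [h]

/-- A functional picking out the supersets of a maximal set of the support evaluates to a
coefficient. -/
theorem exists_mem_support_blockEval_eq {n : ℕ} {F : FlagRing} (hF : F ∈ forms n) (h0 : F ≠ 0) :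
    ∃ p ∈ F.coeff.support, ∀ I, (∀ q ∈ F.coeff.support, (Blocks I q.set ↔ p.set ⊆ q.set)) →
      blockEval I F ≠ 0 := by
  classical
  have hne : F.coeff.support.Nonempty := by
    rw [Finsupp.support_nonempty_iff]
    simpa using h0
  obtain ⟨p, hp, hmax⟩ := Finset.exists_max_image _ (fun p => p.set.card) hne
  rw [mem_forms_iff] at hF
  refine ⟨p, hp, fun I hbl => ?_⟩
  rw [blockEval_apply, Finset.sum_eq_single_of_mem p hp]
  · rw [if_pos ((hbl p hp).2 subset_rfl)]
    exact Finsupp.mem_support_iff.1 hp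
  · intro q hq hqp
    rw [if_neg]
    rw [hbl q hq]
    intro hsub
    refine hqp (ChainOp.ext ((hF q hq).trans (hF p hp).symm) ?_)
    exact (Finset.eq_of_subset_of_card_le hsub (hmax q hq)).symm

/-- The intervals whose only inner point is an element of `U`. -/
def pointIntervals (U : Finset ℕ) : Finset (ℕ × ℕ) := U.image fun u => (u - 1, u + 1)

theorem blocks_pointIntervals {U S : Finset ℕ} (hU : ∀ u ∈ U, 0 < u) :
    Blocks (pointIntervals U) S ↔ U ⊆ S := by
  simp only [Blocks, pointIntervals, Finset.forall_mem_image]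
  refine forall₂_congr fun u hu => ?_
  have := hU u hu
  constructor
  · rintro ⟨s, hs, h1, h2⟩
    obtain rfl : s = u := by omega
    exact hs
  · exact fun h => ⟨u, h, by omega, by omega⟩

theorem pointIntervals_mem_systems {n : ℕ} {U : Finset ℕ} (hU : ∀ u ∈ U, u < n) :
    pointIntervals U ∈ systems n := by
  simp only [mem_systems, pointIntervals, Finset.forall_mem_image]
  intro u hu
  have := hU u hu
  exact ⟨by omega, by omega⟩

theorem pos_lt_of_mem_support {n : ℕ} {F : FlagRing} (hF : F ∈ forms n) {p : ChainOp}
    (hp : p ∈ F.coeff.support) {s : ℕ} (hs : s ∈ p.set) : 0 < s ∧ s < n := by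
  have := Finset.mem_Ioo.1 (p.set_subset hs)
  rwa [mem_forms_iff.1 hF p hp] at this

/-- Block functionals separate forms: point intervals at a maximal set of the support select only
that set's coefficient. -/
theorem exists_blockEval_ne_zero {n : ℕ} {F : FlagRing} (hF : F ∈ forms n) (h0 : F ≠ 0) :
    ∃ I ∈ systems n, blockEval I F ≠ 0 := by
  obtain ⟨p, hp, h⟩ := exists_mem_support_blockEval_eq hF h0
  exact ⟨pointIntervals p.set,
    pointIntervals_mem_systems fun u hu => (pos_lt_of_mem_support hF hp hu).2,
    h _ fun q _ => blocks_pointIntervals fun u hu => (pos_lt_of_mem_support hF hp hu).1⟩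

/-- If either all sets of the support contain `m` or none does, then the intervals around `m` are
not needed to recognize a form. -/
theorem eq_zero_of_blockEval_join {m n : ℕ} {E : FlagRing} (hE : E ∈ forms (m + n))
    (hm : ∀ p ∈ E.coeff.support, ∀ q ∈ E.coeff.support, m ∈ p.set → m ∈ q.set)
    (h : ∀ L ∈ systems m, ∀ R ∈ systems n, blockEval (L ∪ shift m R) E = 0) : E = 0 := by
  by_contra h0
  obtain ⟨p, hp, hI⟩ := exists_mem_support_blockEval_eq hE h0
  have hpos := fun u (hu : u ∈ p.set) => pos_lt_of_mem_support hE hp hu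
  have hhigh : ∀ t ∈ (Finset.Ioo 0 n).filter (· + m ∈ p.set), 0 < t ∧ t < n := fun t ht =>
    Finset.mem_Ioo.1 (Finset.mem_filter.1 ht).1
  have hR := pointIntervals_mem_systems fun t ht => (hhigh t ht).2
  refine hI _ (fun q hq => ?_) (h (pointIntervals (p.set.filter (· < m)))
    (pointIntervals_mem_systems fun u hu => (Finset.mem_filter.1 hu).2)
    (pointIntervals ((Finset.Ioo 0 n).filter (· + m ∈ p.set))) hR)
  rw [blocks_union, blocks_pointIntervals fun u hu => (hpos u (Finset.mem_filter.1 hu).1).1,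
    blocks_high hR (T := (Finset.Ioo 0 n).filter (· + m ∈ q.set))
      (fun t h1 h2 => by simp [h1, h2]),
    blocks_pointIntervals fun t ht => (hhigh t ht).1]
  constructor
  · rintro ⟨h1, h2⟩ u hu
    have := hpos u hu
    rcases lt_trichotomy u m with hum | rfl | hum
    · exact h1 (Finset.mem_filter.2 ⟨hu, hum⟩)
    · exact hm p hp q hq hu
    · have hmem : u - m ∈ (Finset.Ioo 0 n).filter (· + m ∈ p.set) :=
        Finset.mem_filter.2 ⟨Finset.mem_Ioo.2 ⟨by omega, by omega⟩,
          by rwa [Nat.sub_add_cancel hum.le]⟩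
      have h3 := h2 hmem
      rw [Finset.mem_filter, Nat.sub_add_cancel hum.le] at h3
      exact h3.2
  · intro hsub
    refine ⟨(Finset.filter_subset _ _).trans hsub, fun t ht => ?_⟩
    rw [Finset.mem_filter] at ht ⊢
    exact ⟨ht.1, hsub ht.2⟩

theorem exists_blockEval_pos {n : ℕ} {F : FlagRing} (hF : F ∈ nonnegForms n) (h0 : F ≠ 0) :
    ∃ I ∈ systems n, 0 < blockEval I F := by
  obtain ⟨I, hI, h⟩ := exists_blockEval_ne_zero hF.1 h0
  exact ⟨I, hI, lt_of_le_of_ne (hF.2 I hI) h.symm⟩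

theorem mul_mem_nonnegForms {m n : ℕ} {F G : FlagRing} (hF : F ∈ nonnegForms m)
    (hG : G ∈ nonnegForms n) : F * G ∈ nonnegForms (m + n) := by
  refine ⟨mul_mem_forms hF.1 hG.1, fun I hI => ?_⟩
  obtain ⟨L, hL, R, hR, h⟩ := exists_blockEval_mul_eq hF.1 hG.1 hI
  rw [h]
  exact mul_nonneg (hF.2 L hL) (hG.2 R hR)

/-- Functionals that are nonzero on the factors join to one that is nonzero on the product. -/
theorem form_mul_ne_zero {m n : ℕ} {F G : FlagRing} (hF : F ∈ forms m) (hG : G ∈ forms n)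
    (hF0 : F ≠ 0) (hG0 : G ≠ 0) : F * G ≠ 0 := by
  obtain ⟨L, hL, h1⟩ := exists_blockEval_ne_zero hF hF0
  obtain ⟨R, hR, h2⟩ := exists_blockEval_ne_zero hG hG0
  intro h
  have := blockEval_mul hF hG hL hR
  rw [h, map_zero] at this
  exact mul_ne_zero h1 h2 this.symm

/-- With R fixed, the functionals of the product restrict to positive multiples of those of F. -/
theorem mem_nonnegForms_of_mul_left {m n : ℕ} {F G : FlagRing} (hF : F ∈ forms m)
    (hG : G ∈ forms n) (hFG : F * G ∈ nonnegForms (m + n)) {R : Finset (ℕ × ℕ)}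
    (hR : R ∈ systems n) (hR0 : 0 < blockEval R G) : F ∈ nonnegForms m := by
  refine ⟨hF, fun L hL => ?_⟩
  have := hFG.2 _ (union_mem_systems (le_mem_systems (Nat.le_add_right m n) hL)
    (shift_mem_systems (m := m) hR))
  rw [blockEval_mul hF hG hL hR] at this
  exact nonneg_of_mul_nonneg_left this hR0

theorem mem_nonnegForms_of_mul_right {m n : ℕ} {F G : FlagRing} (hF : F ∈ forms m)
    (hG : G ∈ forms n) (hFG : F * G ∈ nonnegForms (m + n)) {L : Finset (ℕ × ℕ)}
    (hL : L ∈ systems m) (hL0 : 0 < blockEval L F) : G ∈ nonnegForms n := by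
  refine ⟨hG, fun R hR => ?_⟩
  have := hFG.2 _ (union_mem_systems (le_mem_systems (Nat.le_add_right m n) hL)
    (shift_mem_systems (m := m) hR))
  rw [blockEval_mul hF hG hL hR] at this
  exact nonneg_of_mul_nonneg_right this hL0

/-! ### Extreme rays characterized by their zeros -/

/-- With finitely many constraints, a direction that vanishes on the tight ones can be scaled so
that moving either way stays feasible. -/
theorem exists_pos_mul_le {α : Type*} (s : Finset α) (f g : α → ℝ) (hf : ∀ a ∈ s, 0 ≤ f a)
    (h : ∀ a ∈ s, f a = 0 → g a = 0) : ∃ ε > 0, ∀ a ∈ s, |ε * g a| ≤ f a := by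
  classical
  induction s using Finset.induction_on with
  | empty => exact ⟨1, one_pos, by simp⟩
  | insert a s _ ih =>
    obtain ⟨ε, hε, h1⟩ := ih (fun b hb => hf b (Finset.mem_insert_of_mem hb))
      (fun b hb => h b (Finset.mem_insert_of_mem hb))
    have ha := Finset.mem_insert_self a s
    obtain ⟨δ, hδ, h2⟩ : ∃ δ > 0, |δ * g a| ≤ f a := by
      rcases (hf a ha).eq_or_lt with h0 | h0
      · exact ⟨1, one_pos, by simp [h a ha h0.symm, ← h0]⟩
      · refine ⟨f a / (|g a| + 1), by positivity, ?_⟩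
        rw [abs_mul, abs_of_nonneg (by positivity), div_mul_eq_mul_div, div_le_iff₀ (by positivity)]
        gcongr
        linarith
    refine ⟨min ε δ, lt_min hε hδ, fun b hb => ?_⟩
    have hmin : 0 < min ε δ := lt_min hε hδ
    rcases Finset.mem_insert.1 hb with rfl | hb
    · refine le_trans ?_ h2
      rw [abs_mul, abs_mul, abs_of_pos hmin, abs_of_pos hδ]
      gcongr
      exact min_le_right _ _
    · refine le_trans ?_ (h1 b hb)
      rw [abs_mul, abs_mul, abs_of_pos hmin, abs_of_pos hε]
      gcongr
      exact min_le_left _ _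

/-- A form that vanishes wherever an extreme ray vanishes is proportional to it. -/
theorem IsExtremeRay.eq_smul_of_vanish {n : ℕ} {F E : FlagRing}
    (hF : IsExtremeRay (nonnegForms n) F) (hE : E ∈ forms n)
    (h : ∀ I ∈ systems n, blockEval I F = 0 → blockEval I E = 0) : ∃ t : ℝ, E = t • F := by
  obtain ⟨hFn, -, hext⟩ := hF
  obtain ⟨ε, hε, hle⟩ := exists_pos_mul_le (systems n) (fun I => blockEval I F)
    (fun I => blockEval I E) hFn.2 h
  -- F is the midpoint of F + εE and F - εE; extremality makes both multiples of F.
  have hp : (2⁻¹ : ℝ) • (F + ε • E) ∈ nonnegForms n := by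
    refine ⟨Submodule.smul_mem _ _ (Submodule.add_mem _ hFn.1 (Submodule.smul_mem _ _ hE)),
      fun I hI => ?_⟩
    have := abs_le.1 (hle I hI)
    simp only [map_smul, map_add, smul_eq_mul]
    linarith
  have hq : (2⁻¹ : ℝ) • (F - ε • E) ∈ nonnegForms n := by
    refine ⟨Submodule.smul_mem _ _ (Submodule.sub_mem _ hFn.1 (Submodule.smul_mem _ _ hE)),
      fun I hI => ?_⟩
    have := abs_le.1 (hle I hI)
    simp only [map_smul, map_sub, smul_eq_mul]
    linarith
  obtain ⟨⟨t, -, ht⟩, -⟩ := hext _ hp _ hq (by module)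
  refine ⟨ε⁻¹ * (2 * t - 1), ?_⟩
  have h2 : ε • E = (2 * t - 1) • F := by
    have : ε • E = (2 : ℝ) • ((2⁻¹ : ℝ) • (F + ε • E)) - F := by module
    rw [this, ht]
    module
  rw [mul_smul, ← h2, smul_smul, inv_mul_cancel₀ hε.ne', one_smul]

/-- A form that is determined up to scalars by its zeros is an extreme ray. -/
theorem isExtremeRay_of_vanish {n : ℕ} {F : FlagRing} (hF : F ∈ nonnegForms n) (h0 : F ≠ 0)
    (h : ∀ E ∈ forms n, (∀ I ∈ systems n, blockEval I F = 0 → blockEval I E = 0) →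
      ∃ t : ℝ, E = t • F) : IsExtremeRay (nonnegForms n) F := by
  have key : ∀ G ∈ nonnegForms n, ∀ H ∈ nonnegForms n, F = G + H → ∃ t : ℝ, 0 ≤ t ∧ G = t • F := by
    intro G hG H hH hGH
    obtain ⟨t, ht⟩ := h G hG.1 fun I hI hI0 => by
      have h1 := hG.2 I hI
      have h2 := hH.2 I hI
      rw [hGH, map_add] at hI0
      linarith
    refine ⟨t, ?_, ht⟩
    obtain ⟨I, hI, hpos⟩ := exists_blockEval_pos hF h0
    have := hG.2 I hI
    rw [ht, map_smul, smul_eq_mul] at this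
    exact nonneg_of_mul_nonneg_left this hpos
  exact ⟨hF, h0, fun G hG H hH hGH =>
    ⟨key G hG H hH hGH, key H hH G hG (hGH.trans (add_comm _ _))⟩⟩

/-! ### Slices of a form -/

open Classical in
/-- The part of a form supported on the sets satisfying `Q`, restricted to the ranks below `m`. -/
def lowSlice (Q : Finset ℕ → Prop) (m : ℕ) : FlagRing →ₗ[ℝ] FlagRing :=
  linExt fun p => if Q p.set then
    chainOp ⟨m, p.set.filter (· ∈ Finset.Ioo 0 m), fun _ h => (Finset.mem_filter.1 h).2⟩ else 0

open Classical in
/-- The part of a form supported on the sets satisfying `Q`, restricted to the ranks strictly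
between `m` and `m + n` and translated by `-m`. -/
def highSlice (Q : Finset ℕ → Prop) (m n : ℕ) : FlagRing →ₗ[ℝ] FlagRing :=
  linExt fun p => if Q p.set then
    chainOp ⟨n, (Finset.Ioo 0 n).filter (· + m ∈ p.set), Finset.filter_subset _ _⟩ else 0

open Classical in
/-- The part of a form supported on the sets satisfying `Q`. -/
def restrict (Q : Finset ℕ → Prop) : FlagRing →ₗ[ℝ] FlagRing :=
  linExt fun p => if Q p.set then chainOp p else 0

theorem lowSlice_mem (Q : Finset ℕ → Prop) (m : ℕ) (F : FlagRing) : lowSlice Q m F ∈ forms m := by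
  refine linExt_mem (forms m) (fun p => ?_) F
  by_cases h : Q p.set
  · rw [if_pos h]
    exact chainOp_mem_forms rfl
  · rw [if_neg h]
    exact Submodule.zero_mem _

theorem highSlice_mem (Q : Finset ℕ → Prop) (m n : ℕ) (F : FlagRing) :
    highSlice Q m n F ∈ forms n := by
  refine linExt_mem (forms n) (fun p => ?_) F
  by_cases h : Q p.set
  · rw [if_pos h]
    exact chainOp_mem_forms rfl
  · rw [if_neg h]
    exact Submodule.zero_mem _

theorem coeff_restrict (Q : Finset ℕ → Prop) [DecidablePred Q] (F : FlagRing) (p : ChainOp) :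
    (restrict Q F).coeff p = if Q p.set then F.coeff p else 0 := by
  classical
  rw [restrict, linExt_apply, MonoidAlgebra.coeff_sum, Finsupp.finsetSum_apply]
  rw [Finset.sum_eq_single p]
  · by_cases h : Q p.set <;> simp [h, chainOp]
  · intro q _ hq
    by_cases h : Q q.set <;> simp [h, chainOp, hq]
  · intro h
    simp [Finsupp.notMem_support_iff.1 h]

theorem restrict_mem {n : ℕ} (Q : Finset ℕ → Prop) {F : FlagRing} (hF : F ∈ forms n) :
    restrict Q F ∈ forms n := by
  classical
  rw [mem_forms_iff] at *
  intro p hp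
  rw [Finsupp.mem_support_iff, coeff_restrict] at hp
  exact hF p (Finsupp.mem_support_iff.2 fun h => hp (by simp [h]))

/-- Exhibits a sum over sets constrained above m as a block functional of a form of degree m, so
that extremality of the left factor applies to it. -/
theorem blockEval_lowSlice (Q : Finset ℕ → Prop) {m : ℕ} {L : Finset (ℕ × ℕ)}
    (hL : L ∈ systems m) (F : FlagRing) :
    blockEval L (lowSlice Q m F) = condEval (fun S => Q S ∧ Blocks L S) F := by
  rw [← LinearMap.comp_apply]
  refine LinearMap.congr_fun (hom_ext_chainOp fun p => ?_) F
  have h : Blocks L (p.set.filter (· ∈ Finset.Ioo 0 m)) ↔ Blocks L p.set :=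
    blocks_low hL fun s h1 h2 => by simp [h1, h2]
  rw [LinearMap.comp_apply, lowSlice, linExt_chainOp]
  by_cases hQ : Q p.set
  · rw [if_pos hQ]
    exact condEval_chainOp_eq (by simp only [hQ, true_and, h])
  · rw [if_neg hQ, map_zero, condEval_chainOp_of_not (fun h => hQ h.1)]

theorem blockEval_highSlice (Q : Finset ℕ → Prop) {m n : ℕ} {R : Finset (ℕ × ℕ)}
    (hR : R ∈ systems n) (F : FlagRing) :
    blockEval R (highSlice Q m n F) = condEval (fun S => Q S ∧ Blocks (shift m R) S) F := by
  rw [← LinearMap.comp_apply]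
  refine LinearMap.congr_fun (hom_ext_chainOp fun p => ?_) F
  have h : Blocks (shift m R) p.set ↔ Blocks R ((Finset.Ioo 0 n).filter (· + m ∈ p.set)) :=
    blocks_high hR fun s h1 h2 => by simp [h1, h2]
  rw [LinearMap.comp_apply, highSlice, linExt_chainOp]
  by_cases hQ : Q p.set
  · rw [if_pos hQ]
    exact condEval_chainOp_eq (by simp only [hQ, true_and, h])
  · rw [if_neg hQ, map_zero, condEval_chainOp_of_not (fun h => hQ h.1)]

theorem blockEval_restrict (Q : Finset ℕ → Prop) (L : Finset (ℕ × ℕ)) (F : FlagRing) :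
    blockEval L (restrict Q F) = condEval (fun S => Q S ∧ Blocks L S) F := by
  rw [← LinearMap.comp_apply]
  refine LinearMap.congr_fun (hom_ext_chainOp fun p => ?_) F
  rw [LinearMap.comp_apply, restrict, linExt_chainOp]
  by_cases hQ : Q p.set
  · rw [if_pos hQ]
    exact condEval_chainOp_eq (by simp only [hQ, true_and])
  · rw [if_neg hQ, map_zero, condEval_chainOp_of_not (fun h => hQ h.1)]

theorem fEmpty_mem_forms (n : ℕ) : fEmpty n ∈ forms n := chainOp_mem_forms rfl

theorem blockEval_empty_fEmpty (n : ℕ) : blockEval ∅ (fEmpty n) = 1 :=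
  condEval_chainOp_of (blocks_empty _)

theorem fEmpty_mem_nonnegForms (n : ℕ) : fEmpty n ∈ nonnegForms n := by
  refine ⟨fEmpty_mem_forms n, fun I _ => ?_⟩
  by_cases h : Blocks I (ChainOp.empty n).set
  · exact (condEval_chainOp_of h).symm ▸ zero_le_one
  · exact (condEval_chainOp_of_not h).ge

theorem fEmpty_ne_zero (n : ℕ) : fEmpty n ≠ 0 := fun h => by
  have := blockEval_empty_fEmpty n
  rw [h, map_zero] at this
  exact zero_ne_one this

theorem linExt_mul (f : ChainOp → FlagRing) (F X : FlagRing) :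
    linExt f F * X = linExt (fun p => f p * X) F := by
  simp [linExt_apply, Finset.sum_mul]

theorem mul_linExt (f : ChainOp → FlagRing) (F X : FlagRing) :
    X * linExt f F = linExt (fun p => X * f p) F := by
  simp [linExt_apply, Finset.mul_sum]

/-- A form all of whose sets have maximum `e` is a multiple of `f_∅` from the right. -/
theorem eq_lowSlice_mul_fEmpty {m e : ℕ} {F : FlagRing} (hF : F ∈ forms m) (he : e < m)
    (h : ∀ p ∈ F.coeff.support, (∀ s ∈ p.set, s ≤ e) ∧ (e = 0 ∨ e ∈ p.set)) :
    F = lowSlice (fun _ => True) e F * fEmpty (m - e) := by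
  rw [lowSlice, linExt_mul]
  -- The slice drops e from each set and the convolution puts it back. For e = 0 all sets are empty,
  -- the slice has degree 0 and nothing is inserted.
  conv_lhs => rw [← linExt_chainOp_self F]
  refine linExt_congr fun p hp => ?_
  rw [if_pos trivial, fEmpty, chainOp_mul]
  congr 1
  have hr := mem_forms_iff.1 hF p hp
  obtain ⟨h1, h2⟩ := h p hp
  ext i
  · rw [ChainOp.mul_rank, hr]
    simp only [ChainOp.empty]
    omega
  · rw [ChainOp.mem_mul_set]
    simp only [ChainOp.empty, Finset.mem_filter, Finset.mem_Ioo, Finset.notMem_empty, false_and,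
      exists_false, or_false]
    constructor
    · intro hi
      have h3 := Finset.mem_Ioo.1 (p.set_subset hi)
      rcases (h1 i hi).eq_or_lt with rfl | h4
      · exact Or.inr ⟨rfl, by omega, by omega⟩
      · exact Or.inl ⟨hi, by omega, h4⟩
    · rintro (hi | ⟨rfl, h3, -⟩)
      · exact hi.1
      · exact h2.resolve_left h3.ne'

/-- A form all of whose sets have minimum `l` is a multiple of `f_∅` from the left. -/
theorem eq_fEmpty_mul_highSlice {m l : ℕ} {F : FlagRing} (hF : F ∈ forms m) (hl : 0 < l)
    (hlm : l ≤ m) (h : ∀ p ∈ F.coeff.support, (∀ s ∈ p.set, l ≤ s) ∧ (l = m ∨ l ∈ p.set)) :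
    F = fEmpty l * highSlice (fun _ => True) l (m - l) F := by
  rw [highSlice, mul_linExt]
  conv_lhs => rw [← linExt_chainOp_self F]
  refine linExt_congr fun p hp => ?_
  rw [if_pos trivial, fEmpty, chainOp_mul]
  congr 1
  have hr := mem_forms_iff.1 hF p hp
  obtain ⟨h1, h2⟩ := h p hp
  ext i
  · rw [ChainOp.mul_rank, hr]
    simp only [ChainOp.empty]
    omega
  · rw [ChainOp.mem_mul_set]
    simp only [ChainOp.empty, Finset.mem_filter, Finset.mem_Ioo, Finset.notMem_empty, false_or]
    constructor
    · intro hi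
      have h3 := Finset.mem_Ioo.1 (p.set_subset hi)
      rcases (h1 i hi).eq_or_lt with rfl | h4
      · exact Or.inl ⟨rfl, hl, by omega⟩
      · exact Or.inr ⟨i - l, ⟨⟨by omega, by omega⟩, by rwa [Nat.sub_add_cancel h4.le]⟩, by omega⟩
    · rintro (⟨rfl, h3, h4⟩ | ⟨t, ht, rfl⟩)
      · exact h2.resolve_left (by omega)
      · exact ht.2

/-! ### Extreme rays divisible by f_∅ -/

/-- If restricting the support of an extreme ray to the sets satisfying `Q` only creates new zeros,
then `Q` is constant on the support. -/
theorem IsExtremeRay.iff_of_mem_support {m : ℕ} {F : FlagRing}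
    (hF : IsExtremeRay (nonnegForms m) F) {J : Finset (ℕ × ℕ)}
    (h : ∀ L ∈ systems m, blockEval L F = 0 → blockEval (L ∪ J) F = 0) {p q : ChainOp}
    (hp : p ∈ F.coeff.support) (hq : q ∈ F.coeff.support) (hpJ : Blocks J p.set) :
    Blocks J q.set := by
  classical
  -- The functional of L on the restricted form is the functional of L ∪ J on F, so the restriction
  -- is t • F; comparing coefficients at p and q gives the claim.
  obtain ⟨t, ht⟩ := hF.eq_smul_of_vanish (restrict_mem (Blocks J) hF.1.1) fun L hL h0 => by
    rw [blockEval_restrict, ← h L hL h0, blockEval]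
    exact condEval_congr hF.1.1 fun S _ => by rw [blocks_union, and_comm]
  have hc : ∀ r, (if Blocks J r.set then F.coeff r else 0) = t * F.coeff r := fun r => by
    rw [← coeff_restrict, ht, MonoidAlgebra.coeff_smul_apply, smul_eq_mul]
  rw [Finsupp.mem_support_iff] at hp hq
  have h1 := hc p
  have h2 := hc q
  rw [if_pos hpJ] at h1
  have ht0 : t ≠ 0 := by
    rintro rfl
    exact hp (by rw [h1, zero_mul])
  by_contra hqJ
  rw [if_neg hqJ] at h2
  exact mul_ne_zero ht0 hq h2.symm

theorem IsExtremeRay.support_nonempty {m : ℕ} {F : FlagRing}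
    (hF : IsExtremeRay (nonnegForms m) F) : F.coeff.support.Nonempty := by
  rw [Finsupp.support_nonempty_iff]
  simpa using hF.2.1

/-- For each j, either all sets of the support have an element above j or none has. Hence they share
a maximum e (0 for the empty set), and F can be cut at e with k = m - e. -/
theorem IsExtremeRay.exists_eq_mul_fEmpty {m : ℕ} (hm : 0 < m) {F : FlagRing}
    (hF : IsExtremeRay (nonnegForms m) F)
    (h : ∀ j < m, ∀ L ∈ systems m, blockEval L F = 0 → blockEval (L ∪ {(j, m)}) F = 0) :
    ∃ (k : ℕ) (F' : FlagRing), 1 ≤ k ∧ k ≤ m ∧ F' ∈ forms (m - k) ∧ F = F' * fEmpty k := by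
  obtain ⟨p, hp⟩ := hF.support_nonempty
  have hsub : ∀ q ∈ F.coeff.support, ∀ s ∈ q.set, 0 < s ∧ s < m := fun q hq s hs =>
    pos_lt_of_mem_support hF.1.1 hq hs
  set e := p.set.sup id with he
  have hle : ∀ s ∈ p.set, s ≤ e := fun s hs => Finset.le_sup (f := id) hs
  have hmem : e = 0 ∨ e ∈ p.set := by
    rcases p.set.eq_empty_or_nonempty with h0 | h0
    · left
      rw [he, h0]
      rfl
    · right
      obtain ⟨s, hs, hs'⟩ := Finset.exists_mem_eq_sup p.set h0 id
      rw [he, hs']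
      exact hs
  have hem : e < m := by
    rcases hmem with h0 | h0
    · omega
    · exact (hsub p hp e h0).2
  refine ⟨m - e, lowSlice (fun _ => True) e F, by omega, by omega, ?_,
    eq_lowSlice_mul_fEmpty hF.1.1 hem fun q hq => ⟨fun s hs => ?_, ?_⟩⟩
  · rw [Nat.sub_sub_self hem.le]
    exact lowSlice_mem _ _ _
  · by_contra hlt
    push Not at hlt
    obtain ⟨s', hs', h1, -⟩ := blocks_singleton.1 (hF.iff_of_mem_support (h e hem) hq hp
      (blocks_singleton.2 ⟨s, hs, hlt, (hsub q hq s hs).2⟩))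
    exact absurd (hle s' hs') (by omega)
  · refine hmem.imp_right fun h0 => ?_
    have h1 := (hsub p hp e h0).1
    -- The interval (e - 1, m) gives an element at least e, and (e, m) excludes anything larger.
    obtain ⟨s', hs', h2, h3⟩ := blocks_singleton.1 (hF.iff_of_mem_support (h (e - 1) (by omega)) hp hq
      (blocks_singleton.2 ⟨e, h0, by omega, hem⟩))
    have hse : s' ≤ e := by
      by_contra hlt
      push Not at hlt
      obtain ⟨s'', hs'', h1, -⟩ := blocks_singleton.1 (hF.iff_of_mem_support (h e hem) hq hp
        (blocks_singleton.2 ⟨s', hs', hlt, h3⟩))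
      exact absurd (hle s'' hs'') (by omega)
    obtain rfl : s' = e := by omega
    exact hs'

/-- Mirror image: the sets of the support share a minimum, where the empty set is given minimum m.
-/
theorem IsExtremeRay.exists_eq_fEmpty_mul {m : ℕ} (hm : 0 < m) {F : FlagRing}
    (hF : IsExtremeRay (nonnegForms m) F)
    (h : ∀ j, 0 < j → j ≤ m → ∀ L ∈ systems m, blockEval L F = 0 →
      blockEval (L ∪ {(0, j)}) F = 0) :
    ∃ (l : ℕ) (F' : FlagRing), 1 ≤ l ∧ l ≤ m ∧ F' ∈ forms (m - l) ∧ F = fEmpty l * F' := by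
  obtain ⟨p, hp⟩ := hF.support_nonempty
  have hsub : ∀ q ∈ F.coeff.support, ∀ s ∈ q.set, 0 < s ∧ s < m := fun q hq s hs =>
    pos_lt_of_mem_support hF.1.1 hq hs
  obtain ⟨e, he0, hem, hle, hmem⟩ : ∃ e, 0 < e ∧ e ≤ m ∧ (∀ s ∈ p.set, e ≤ s) ∧
      (e = m ∨ e ∈ p.set) := by
    rcases p.set.eq_empty_or_nonempty with h0 | h0
    · exact ⟨m, hm, le_rfl, by simp [h0], Or.inl rfl⟩
    · obtain ⟨e, he, hmin⟩ := Finset.exists_min_image p.set id h0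
      exact ⟨e, (hsub p hp e he).1, (hsub p hp e he).2.le, hmin, Or.inr he⟩
  have hall : ∀ q ∈ F.coeff.support, ∀ s ∈ q.set, e ≤ s := fun q hq s hs => by
    by_contra hlt
    push Not at hlt
    obtain ⟨s', hs', -, h1⟩ := blocks_singleton.1 (hF.iff_of_mem_support (h e he0 hem) hq hp
      (blocks_singleton.2 ⟨s, hs, (hsub q hq s hs).1, hlt⟩))
    exact absurd (hle s' hs') (by omega)
  refine ⟨e, highSlice (fun _ => True) e (m - e) F, he0, hem, highSlice_mem _ _ _ _,
    eq_fEmpty_mul_highSlice hF.1.1 he0 hem fun q hq => ⟨hall q hq, hmem.imp_right fun h0 => ?_⟩⟩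
  have h1 := (hsub p hp e h0).2
  obtain ⟨s', hs', h2, h3⟩ := blocks_singleton.1 (hF.iff_of_mem_support
    (h (e + 1) (by omega) (by omega)) hp hq (blocks_singleton.2 ⟨e, h0, he0, by omega⟩))
  have := hall q hq s' hs'
  obtain rfl : s' = e := by omega
  exact hs'

/-! ### Forms vanishing wherever a product does -/

/-- A family of numbers that is linear in each of two arguments and vanishes wherever a product
of two extreme rays does is proportional to this product. -/
theorem exists_eq_mul_of_vanish {m n : ℕ} {F G : FlagRing} (hF : IsExtremeRay (nonnegForms m) F)
    (hG : IsExtremeRay (nonnegForms n) G) (ψ : Finset (ℕ × ℕ) → Finset (ℕ × ℕ) → ℝ)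
    (h1 : ∀ R ∈ systems n, ∃ E ∈ forms m, ∀ L ∈ systems m, ψ L R = blockEval L E)
    (h2 : ∀ L ∈ systems m, ∃ E ∈ forms n, ∀ R ∈ systems n, ψ L R = blockEval R E)
    (h0 : ∀ L ∈ systems m, ∀ R ∈ systems n, blockEval L F * blockEval R G = 0 → ψ L R = 0) :
    ∃ t : ℝ, ∀ L ∈ systems m, ∀ R ∈ systems n, ψ L R = t * (blockEval L F * blockEval R G) := by
  -- The row at L₀ is a multiple of G and every column is a multiple of F; evaluating a column at L₀
  -- determines its factor.
  obtain ⟨L₀, hL₀, hpos⟩ := exists_blockEval_pos hF.1 hF.2.1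
  obtain ⟨E, hE, hψ⟩ := h2 L₀ hL₀
  obtain ⟨t, rfl⟩ := hG.eq_smul_of_vanish hE fun R hR hR0 => by
    rw [← hψ R hR, h0 L₀ hL₀ R hR (by rw [hR0, mul_zero])]
  refine ⟨t / blockEval L₀ F, fun L hL R hR => ?_⟩
  obtain ⟨E', hE', hψ'⟩ := h1 R hR
  obtain ⟨s, rfl⟩ := hF.eq_smul_of_vanish hE' fun L hL hL0 => by
    rw [← hψ' L hL, h0 L hL R hR (by rw [hL0, zero_mul])]
  have e1 := hψ R hR
  rw [hψ' L₀ hL₀, map_smul, map_smul, smul_eq_mul, smul_eq_mul] at e1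
  rw [hψ' L hL, map_smul, smul_eq_mul]
  field_simp
  linear_combination blockEval L F * e1

/-- A set containing m meets (j, m + 1) at m; a set avoiding m meets it only through (j, m).
Straddling intervals thus test the part avoiding m against an enlarged left system. -/
theorem blockEval_union_straddle_left {m N j : ℕ} {H : FlagRing} (hH : H ∈ forms N)
    (L R : Finset (ℕ × ℕ)) (hj : j < m) : blockEval (L ∪ shift m R ∪ {(j, m + 1)}) H =
      condEval (fun S => Blocks (L ∪ shift m R) S ∧ m ∈ S) H +
      condEval (fun S => Blocks (L ∪ {(j, m)} ∪ shift m R) S ∧ m ∉ S) H := by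
  rw [blockEval, ← condEval_and_add _ (fun S => m ∈ S)]
  congr 1
  · refine condEval_congr hH fun S _ => ?_
    rw [blocks_union (J := {_}), blocks_singleton]
    exact and_congr_left fun hmS => and_iff_left ⟨m, hmS, hj, by omega⟩
  · refine condEval_congr hH fun S _ => ?_
    simp only [blocks_union, blocks_singleton]
    refine and_congr_left fun hmS => ?_
    have : (∃ s ∈ S, j < s ∧ s < m + 1) ↔ ∃ s ∈ S, j < s ∧ s < m := by
      refine exists_congr fun s => and_congr_right fun hsS => and_congr_right fun _ => ?_
      have : s ≠ m := fun h => hmS (h ▸ hsS)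
      omega
    rw [this, and_right_comm]

theorem blockEval_union_straddle_right {m N j : ℕ} {H : FlagRing} (hH : H ∈ forms N)
    (L R : Finset (ℕ × ℕ)) (hm : 0 < m) (hj : 0 < j) :
    blockEval (L ∪ shift m R ∪ {(m - 1, j + m)}) H =
      condEval (fun S => Blocks (L ∪ shift m R) S ∧ m ∈ S) H +
      condEval (fun S => Blocks (L ∪ shift m (R ∪ {(0, j)})) S ∧ m ∉ S) H := by
  rw [blockEval, ← condEval_and_add _ (fun S => m ∈ S)]
  congr 1
  · refine condEval_congr hH fun S _ => ?_
    rw [blocks_union (J := {_}), blocks_singleton]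
    exact and_congr_left fun hmS => and_iff_left ⟨m, hmS, by omega, by omega⟩
  · refine condEval_congr hH fun S _ => ?_
    have hsh : shift m (R ∪ {(0, j)}) = shift m R ∪ {(m, j + m)} := by
      simp [shift]
    rw [hsh]
    simp only [blocks_union, blocks_singleton]
    refine and_congr_left fun hmS => ?_
    have : (∃ s ∈ S, m - 1 < s ∧ s < j + m) ↔ ∃ s ∈ S, m < s ∧ s < j + m := by
      refine exists_congr fun s => and_congr_right fun hsS => and_congr_left fun _ => ?_
      have : s ≠ m := fun h => hmS (h ▸ hsS)
      omega
    rw [this, and_assoc]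

theorem mem_set_of_mem_support_mul {m n : ℕ} (hm : 0 < m) (hn : 0 < n) {F G : FlagRing}
    (hF : F ∈ forms m) (hG : G ∈ forms n) : ∀ p ∈ (F * G).coeff.support, m ∈ p.set := by
  classical
  intro p hp
  obtain ⟨q, hq, r, hr, rfl⟩ := Finset.mem_mul.1 (MonoidAlgebra.support_coeff_mul_subset _ _ hp)
  have h1 := mem_forms_iff.1 hF q hq
  have h2 := mem_forms_iff.1 hG r hr
  rw [ChainOp.mem_mul_set]
  exact Or.inr (Or.inl ⟨h1.symm, by omega, by omega⟩)

/-- A form vanishing wherever a product of two extreme rays vanishes is proportional to it, unless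
both factors can be divided by some `f_∅` on the inner side. -/
theorem eq_smul_mul_of_vanish {m n : ℕ} (hm : 0 < m) (hn : 0 < n) {F G H : FlagRing}
    (hF : IsExtremeRay (nonnegForms m) F) (hG : IsExtremeRay (nonnegForms n) G)
    (hFG : ¬ ∃ (k l : ℕ) (F' G' : FlagRing), 1 ≤ k ∧ k ≤ m ∧ 1 ≤ l ∧ l ≤ n ∧
      F' ∈ forms (m - k) ∧ G' ∈ forms (n - l) ∧ F = F' * fEmpty k ∧ G = fEmpty l * G')
    (hH : H ∈ forms (m + n))
    (h : ∀ I ∈ systems (m + n), blockEval I (F * G) = 0 → blockEval I H = 0) :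
    ∃ t : ℝ, H = t • (F * G) := by
  have hFf := hF.1.1
  have hGf := hG.1.1
  -- the contributions to `H` of the sets containing `m`, and of the others
  let inn : Finset (ℕ × ℕ) → Finset (ℕ × ℕ) → ℝ := fun L R =>
    condEval (fun S => Blocks (L ∪ shift m R) S ∧ m ∈ S) H
  let out : Finset (ℕ × ℕ) → Finset (ℕ × ℕ) → ℝ := fun L R =>
    condEval (fun S => Blocks (L ∪ shift m R) S ∧ m ∉ S) H
  have hadd : ∀ L R, inn L R + out L R = blockEval (L ∪ shift m R) H := fun L R =>
    condEval_and_add _ _ H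
  have hjoin : ∀ L ∈ systems m, ∀ R ∈ systems n, L ∪ shift m R ∈ systems (m + n) :=
    fun L hL R hR => union_mem_systems (le_mem_systems (Nat.le_add_right m n) hL)
      (shift_mem_systems hR)
  -- Adding a straddling interval leaves the value on F * G unchanged, so its zeros give additional
  -- zeros of H.
  have hzero : ∀ L ∈ systems m, ∀ R ∈ systems n, blockEval L F * blockEval R G = 0 →
      ∀ i < m, ∀ j, m < j → j ≤ m + n → blockEval (L ∪ shift m R ∪ {(i, j)}) H = 0 :=
    fun L hL R hR h0 i hi j hj hj' => h _
      (union_mem_systems (hjoin L hL R hR) (singleton_mem_systems (by omega) hj'))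
      (by rw [blockEval_mul_straddle hFf hGf hL hR hm hn hi hj, h0])
  have hinn0 : ∀ L ∈ systems m, ∀ R ∈ systems n, blockEval L F * blockEval R G = 0 →
      inn L R = 0 := fun L hL R hR h0 => by
    -- The only inner point of (m - 1, m + 1) is m, so this interval selects the sets containing m.
    rw [← hzero L hL R hR h0 (m - 1) (by omega) (m + 1) (by omega) (by omega)]
    refine condEval_congr hH fun S _ => ?_
    rw [blocks_union (J := {_}), blocks_singleton]
    refine and_congr_right fun _ => ⟨fun h => ⟨m, h, by omega, by omega⟩, ?_⟩
    rintro ⟨s, hs, h1, h2⟩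
    obtain rfl : s = m := by omega
    exact hs
  have hout0 : ∀ L ∈ systems m, ∀ R ∈ systems n, blockEval L F * blockEval R G = 0 →
      out L R = 0 := fun L hL R hR h0 => by
    have h1 := hadd L R
    rwa [hinn0 L hL R hR h0, zero_add,
      h _ (hjoin L hL R hR) (by rw [blockEval_mul hFf hGf hL hR, h0])] at h1
  have hlow : ∀ (C : Finset ℕ → Prop), ∀ R ∈ systems n, ∃ E ∈ forms m, ∀ L ∈ systems m,
      condEval (fun S => Blocks (L ∪ shift m R) S ∧ C S) H = blockEval L E := fun C R _ =>
    ⟨lowSlice (fun S => Blocks (shift m R) S ∧ C S) m H, lowSlice_mem _ _ _, fun L hL => by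
      rw [blockEval_lowSlice _ hL]
      refine condEval_congr hH fun S _ => ?_
      rw [blocks_union]
      tauto⟩
  have hhigh : ∀ (C : Finset ℕ → Prop), ∀ L ∈ systems m, ∃ E ∈ forms n, ∀ R ∈ systems n,
      condEval (fun S => Blocks (L ∪ shift m R) S ∧ C S) H = blockEval R E := fun C L _ =>
    ⟨highSlice (fun S => Blocks L S ∧ C S) m n H, highSlice_mem _ _ _ _, fun R hR => by
      rw [blockEval_highSlice _ hR]
      refine condEval_congr hH fun S _ => ?_
      rw [blocks_union]
      tauto⟩
  obtain ⟨s, hs⟩ := exists_eq_mul_of_vanish hF hG inn (hlow _) (hhigh _) hinn0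
  obtain ⟨t, ht⟩ := exists_eq_mul_of_vanish hF hG out (hlow _) (hhigh _) hout0
  obtain ⟨L₀, hL₀, hFpos⟩ := exists_blockEval_pos hF.1 hF.2.1
  obtain ⟨R₀, hR₀, hGpos⟩ := exists_blockEval_pos hG.1 hG.2.1
  -- Where F or G vanishes, the sets containing m contribute nothing to a straddling functional, so
  -- the sets avoiding m must contribute 0 on the enlarged system too. If t ≠ 0, this forces the
  -- zeros of F and of G to persist, and both become divisible by f_∅.
  have ht0 : t = 0 := by
    by_contra hne
    refine hFG ?_
    have hA : ∀ j < m, ∀ L ∈ systems m, blockEval L F = 0 →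
        blockEval (L ∪ {(j, m)}) F = 0 := fun j hj L hL h0 => by
      have h1 := hzero L hL R₀ hR₀ (by rw [h0, zero_mul]) j hj (m + 1) (by omega) (by omega)
      have hL' : L ∪ {(j, m)} ∈ systems m :=
        union_mem_systems hL (singleton_mem_systems hj.le le_rfl)
      have h2 := blockEval_union_straddle_left hH L R₀ hj
      have h3 := hinn0 L hL R₀ hR₀ (by rw [h0, zero_mul])
      have h4 := ht _ hL' _ hR₀
      dsimp only [inn, out] at h3 h4
      rw [h1, h3, zero_add, h4] at h2
      by_contra hc
      exact mul_ne_zero hne (mul_ne_zero hc hGpos.ne') h2.symm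
    have hB : ∀ j, 0 < j → j ≤ n → ∀ R ∈ systems n, blockEval R G = 0 →
        blockEval (R ∪ {(0, j)}) G = 0 := fun j hj hjn R hR h0 => by
      have h1 := hzero L₀ hL₀ R hR (by rw [h0, mul_zero]) (m - 1) (by omega) (j + m) (by omega)
        (by omega)
      have hR' : R ∪ {(0, j)} ∈ systems n :=
        union_mem_systems hR (singleton_mem_systems (Nat.zero_le _) hjn)
      have h2 := blockEval_union_straddle_right hH L₀ R hm hj
      have h3 := hinn0 L₀ hL₀ R hR (by rw [h0, mul_zero])
      have h4 := ht _ hL₀ _ hR'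
      dsimp only [inn, out] at h3 h4
      rw [h1, h3, zero_add, h4] at h2
      by_contra hc
      exact mul_ne_zero hne (mul_ne_zero hFpos.ne' hc) h2.symm
    obtain ⟨k, F', hk, hkm, hF', hFF'⟩ := hF.exists_eq_mul_fEmpty hm hA
    obtain ⟨l, G', hl, hln, hG', hGG'⟩ := hG.exists_eq_fEmpty_mul hn hB
    exact ⟨k, l, F', G', hk, hkm, hl, hln, hF', hG', hFF', hGG'⟩
  subst ht0
  refine ⟨s, sub_eq_zero.1 ?_⟩
  -- With t = 0 every joined functional kills the part of H avoiding m, and these functionals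
  -- determine that part.
  have hHm : ∀ p ∈ H.coeff.support, m ∈ p.set := by
    classical
    have h0 : restrict (fun S => m ∉ S) H = 0 := by
      refine eq_zero_of_blockEval_join (restrict_mem _ hH) (fun p hp _ _ hpm => ?_)
        fun L hL R hR => ?_
      · rw [Finsupp.mem_support_iff, coeff_restrict] at hp
        exact absurd hpm (ite_ne_right_iff.1 hp).1
      · rw [blockEval_restrict, ← (ht L hL R hR).trans (zero_mul _)]
        exact condEval_congr hH fun S _ => and_comm
    intro p hp
    by_contra hpm
    have h1 := coeff_restrict (fun S => m ∉ S) H p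
    rw [h0, if_pos hpm] at h1
    exact Finsupp.mem_support_iff.1 hp h1.symm
  have hFGm := mem_set_of_mem_support_mul hm hn hFf hGf
  have hsup : ∀ p ∈ (H - s • (F * G)).coeff.support, m ∈ p.set := fun p hp => by
    by_contra hpm
    have h1 : H.coeff p = 0 := by
      by_contra hc
      exact hpm (hHm p (Finsupp.mem_support_iff.2 hc))
    have h2 : (F * G).coeff p = 0 := by
      by_contra hc
      exact hpm (hFGm p (Finsupp.mem_support_iff.2 hc))
    refine Finsupp.mem_support_iff.1 hp ?_
    rw [sub_eq_add_neg, ← neg_smul, MonoidAlgebra.coeff_add, Finsupp.add_apply, h1,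
      MonoidAlgebra.coeff_smul_apply, h2, smul_zero, add_zero]
  refine eq_zero_of_blockEval_join (Submodule.sub_mem _ hH (Submodule.smul_mem _ _
    (mul_mem_forms hFf hGf))) (fun p _ q hq _ => hsup q hq) fun L hL R hR => ?_
  rw [map_sub, map_smul, blockEval_mul hFf hGf hL hR, ← hadd, hs L hL R hR, ht L hL R hR,
    smul_eq_mul]
  ring

/-! ### Flag numbers as counts of lexicographically first maximal chains -/

theorem eq_of_le_of_grade_eq {P : Type*} [PartialOrder P] [GradeOrder ℕ P] {x y : P} (h : x ≤ y)
    (hg : grade ℕ x = grade ℕ y) : x = y := by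
  by_contra hne
  exact (grade_strictMono (𝕆 := ℕ) (lt_of_le_of_ne h hne)).ne hg

section RankChains

variable (P : Type) [PartialOrder P] [BoundedOrder P] [GradeMinOrder ℕ P]

/-- The maximal chains of a graded poset, listed by rank and continued constantly. -/
def rankChains : Set (ℕ → P) :=
  {c | Monotone c ∧ ∀ i, grade ℕ (c i) = min i (grade ℕ (⊤ : P))}

variable {P}

theorem rankChains.apply_eq_top {c : ℕ → P} (hc : c ∈ rankChains P) {i : ℕ}
    (hi : grade ℕ (⊤ : P) ≤ i) : c i = ⊤ :=
  eq_of_le_of_grade_eq le_top (by rw [hc.2, min_eq_right hi])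

theorem rankChains.apply_zero {c : ℕ → P} (hc : c ∈ rankChains P) : c 0 = ⊥ :=
  (eq_of_le_of_grade_eq bot_le (by rw [hc.2, grade_bot]; simp)).symm

theorem rankChains.grade_apply {c : ℕ → P} (hc : c ∈ rankChains P) {i : ℕ}
    (hi : i ≤ grade ℕ (⊤ : P)) : grade ℕ (c i) = i := by
  rw [hc.2, min_eq_left hi]

theorem rankChains.isChain_image {c : ℕ → P} (hc : c ∈ rankChains P) (S : Finset ℕ)
    [DecidableEq P] : IsChain (· ≤ ·) ((S.image c : Finset P) : Set P) := by
  rw [Finset.coe_image]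
  rintro _ ⟨i, -, rfl⟩ _ ⟨j, -, rfl⟩ -
  rcases le_total i j with h | h
  · exact Or.inl (hc.1 h)
  · exact Or.inr (hc.1 h)

theorem finite_rankChains [Finite P] : (rankChains P).Finite := by
  refine Set.Finite.of_finite_image (f := fun c (i : Fin (grade ℕ (⊤ : P))) => c i)
    (Set.toFinite _) ?_
  intro c hc c' hc' h
  funext i
  rcases lt_or_ge i (grade ℕ (⊤ : P)) with hi | hi
  · exact congrFun h ⟨i, hi⟩
  · rw [rankChains.apply_eq_top hc hi, rankChains.apply_eq_top hc' hi]

/-- Between x and the next element y of the flag, a cover z of x with z ≤ y is comparable to the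
whole flag, hence belongs to it by maximality. -/
theorem exists_mem_flag_grade_eq [Finite P] (M : Flag P) {i : ℕ} (hi : i ≤ grade ℕ (⊤ : P)) :
    ∃ x ∈ M, grade ℕ x = i := by
  induction i with
  | zero => exact ⟨⊥, M.bot_mem, by rw [grade_bot]; rfl⟩
  | succ i ih =>
    obtain ⟨x, hx, rfl⟩ := ih (by omega)
    have hxt : x < ⊤ := lt_top_iff_ne_top.2 fun h => by rw [h] at hi; omega
    obtain ⟨y, ⟨hyM, hxy⟩, hmin⟩ := (Set.toFinite {y | y ∈ M ∧ x < y}).exists_minimal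
      ⟨⊤, M.top_mem, hxt⟩
    obtain ⟨z, hxz, hzy⟩ := exists_covBy_le_of_lt hxy
    refine ⟨z, M.mem_iff_forall_le_or_ge.2 fun b hb => ?_, ?_⟩
    · rcases M.le_or_le hb hx with h | h
      · exact Or.inr (h.trans hxz.le)
      rcases h.eq_or_lt with rfl | h
      · exact Or.inr hxz.le
      rcases M.le_or_le hb hyM with h' | h'
      · exact Or.inl (hzy.trans (hmin ⟨hb, h⟩ h'))
      · exact Or.inl (hzy.trans h')
    · exact (Nat.covBy_iff_add_one_eq.1 (hxz.grade ℕ)).symm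

theorem exists_rankChain_of_isChain [Finite P] {C : Set P} (hC : IsChain (· ≤ ·) C) :
    ∃ c ∈ rankChains P, ∀ x ∈ C, c (grade ℕ x) = x := by
  obtain ⟨M, hM⟩ := hC.exists_subset_flag
  have hex : ∀ i, ∃ x ∈ M, grade ℕ x = min i (grade ℕ (⊤ : P)) := fun i =>
    exists_mem_flag_grade_eq M (min_le_right _ _)
  choose c hcM hc using hex
  have huniq : ∀ x ∈ M, ∀ y ∈ M, grade ℕ x = grade ℕ y → x = y := fun x hx y hy h => by
    rcases M.le_or_le hx hy with h' | h'
    · exact eq_of_le_of_grade_eq h' h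
    · exact (eq_of_le_of_grade_eq h' h.symm).symm
  refine ⟨c, ⟨fun i j hij => ?_, hc⟩, fun x hx => huniq _ (hcM _) _ (hM hx) ?_⟩
  · rcases M.le_or_le (hcM i) (hcM j) with h | h
    · exact h
    · refine (eq_of_le_of_grade_eq h (le_antisymm (grade_mono h) ?_)).ge
      rw [hc, hc]
      exact min_le_min_right _ hij
  · rw [hc, min_eq_left (grade_mono le_top)]

/-- The position of a chain in the lexicographic order given by a numbering of the poset. -/
def chainCode (e : P → ℕ) (c : ℕ → P) : Lex (ℕ → ℕ) := toLex fun i => e (c i)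

open Classical in
/-- The intervals of ranks in which a maximal chain can be changed to a lexicographically smaller
one. -/
def improvable (e : P → ℕ) (c : ℕ → P) : Finset (ℕ × ℕ) :=
  (Finset.range (grade ℕ (⊤ : P) + 1) ×ˢ Finset.range (grade ℕ (⊤ : P) + 1)).filter fun q =>
    ∃ c' ∈ rankChains P, (∀ s, ¬ (q.1 < s ∧ s < q.2) → c' s = c s) ∧
      chainCode e c' < chainCode e c

theorem improvable_mem_systems (e : P → ℕ) (c : ℕ → P) :
    improvable e c ∈ systems (grade ℕ (⊤ : P)) := by
  classical
  exact Finset.mem_powerset.2 (Finset.filter_subset _ _)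

/-- Let d be the first rank where the chains differ and j the next rank where they agree again.
Replacing c by c' only on the ranks from d to j - 1 already gives a smaller maximal chain. -/
theorem exists_improvable {e : P → ℕ} {c c' : ℕ → P} (hc : c ∈ rankChains P)
    (hc' : c' ∈ rankChains P) (hlt : chainCode e c' < chainCode e c) (he : Function.Injective e) :
    ∃ q ∈ improvable e c, ∀ s, q.1 < s → s < q.2 → c' s ≠ c s := by
  classical
  obtain ⟨d, hd, hdlt⟩ := hlt
  have hd : ∀ j < d, c' j = c j := fun j hj => he (hd j hj)
  have hdne : c' d ≠ c d := fun h => hdlt.ne (congrArg e h)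
  have hdn : d < grade ℕ (⊤ : P) := by
    by_contra h
    push Not at h
    exact hdne (by rw [rankChains.apply_eq_top hc h, rankChains.apply_eq_top hc' h])
  have hd0 : 0 < d := by
    rcases Nat.eq_zero_or_pos d with rfl | h
    · exact absurd ((rankChains.apply_zero hc').trans (rankChains.apply_zero hc).symm) hdne
    · exact h
  have hex : ∃ j, d < j ∧ c' j = c j := ⟨grade ℕ (⊤ : P), hdn, by
    rw [rankChains.apply_eq_top hc le_rfl, rankChains.apply_eq_top hc' le_rfl]⟩
  obtain ⟨hj, hcj⟩ := Nat.find_spec hex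
  have hjn : Nat.find hex ≤ grade ℕ (⊤ : P) := Nat.find_min' hex ⟨hdn, by
    rw [rankChains.apply_eq_top hc le_rfl, rankChains.apply_eq_top hc' le_rfl]⟩
  have hmin : ∀ s, d < s → s < Nat.find hex → c' s ≠ c s := fun s h1 h2 h3 =>
    Nat.find_min hex h2 ⟨h1, h3⟩
  generalize Nat.find hex = j at *
  let c'' : ℕ → P := fun s => if d ≤ s ∧ s < j then c' s else c s
  have h1 : ∀ s ≤ j, c'' s = c' s := fun s hs => by
    by_cases h : d ≤ s ∧ s < j
    · exact if_pos h
    · rw [show c'' s = c s from if_neg h]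
      rcases lt_or_ge s d with h' | h'
      · exact (hd s h').symm
      · obtain rfl : s = j := by omega
        exact hcj.symm
  have h2 : ∀ s, j ≤ s → c'' s = c s := fun s hs => if_neg (by omega)
  -- The left endpoint is d - 1 because the interval is open; d > 0 since both chains start at ⊥.
  refine ⟨(d - 1, j), Finset.mem_filter.2 ⟨?_, c'', ⟨monotone_nat_of_le_succ fun s => ?_,
    fun s => ?_⟩, fun s hs => if_neg (by omega), ⟨d, fun s hs => ?_, ?_⟩⟩, fun s hs1 hs2 => ?_⟩
  · simp only [Finset.mem_product, Finset.mem_range]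
    omega
  · rcases lt_or_ge s j with h | h
    · rw [h1 s h.le, h1 (s + 1) h]
      exact hc'.1 (Nat.le_succ s)
    · rw [h2 s h, h2 (s + 1) (by omega)]
      exact hc.1 (Nat.le_succ s)
  · rcases le_total s j with h | h
    · rw [h1 s h, hc'.2]
    · rw [h2 s h, hc.2]
  · exact congrArg e (if_neg (by omega))
  · have : c'' d = c' d := if_pos ⟨le_rfl, hj⟩
    change e (c'' d) < e (c d)
    rw [this]
    exact hdlt
  · dsimp only at hs1 hs2
    rcases eq_or_ne s d with rfl | hne
    · exact hdne
    · exact hmin s (by omega) hs2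

/-- A smaller chain agreeing with c on S yields an improvable interval throughout which it differs
from c, so S misses it. Conversely, an improvement inside an interval missed by S does not touch the
ranks in S. -/
theorem blocks_improvable_iff {e : P → ℕ} (he : Function.Injective e) {c : ℕ → P}
    (hc : c ∈ rankChains P) {S : Finset ℕ} : Blocks (improvable e c) S ↔
      ∀ c' ∈ rankChains P, (∀ s ∈ S, c' s = c s) → chainCode e c ≤ chainCode e c' := by
  classical
  constructor
  · intro h c' hc' hS
    by_contra hlt
    obtain ⟨q, hq, hne⟩ := exists_improvable hc hc' (not_le.1 hlt) he
    obtain ⟨s, hs, h1, h2⟩ := h q hq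
    exact hne s h1 h2 (hS s hs)
  · intro h q hq
    by_contra hq'
    push Not at hq'
    obtain ⟨-, c', hc', hag, hlt⟩ := Finset.mem_filter.1 hq
    exact absurd (h c' hc' fun s hs => hag s fun h => absurd (hq' s hs h.1) (not_le.2 h.2))
      (not_le.2 hlt)

theorem image_grade_image {c : ℕ → P} (hc : c ∈ rankChains P) {S : Finset ℕ} [DecidableEq P]
    (hS : S ⊆ Finset.Ioo 0 (grade ℕ (⊤ : P))) : (S.image c).image (grade ℕ) = S := by
  rw [Finset.image_image]
  conv_rhs => rw [← Finset.image_id (s := S)]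
  exact Finset.image_congr fun s hs =>
    rankChains.grade_apply hc (Finset.mem_Ioo.1 (hS hs)).2.le

theorem apply_eq_of_image_eq {c c' : ℕ → P} (hc : c ∈ rankChains P) (hc' : c' ∈ rankChains P)
    {S : Finset ℕ} [DecidableEq P] (hS : S ⊆ Finset.Ioo 0 (grade ℕ (⊤ : P)))
    (h : S.image c = S.image c') {s : ℕ} (hs : s ∈ S) : c s = c' s := by
  have h1 : c s ∈ S.image c' := h ▸ Finset.mem_image_of_mem c hs
  obtain ⟨t, ht, hts⟩ := Finset.mem_image.1 h1
  have h2 := congrArg (grade ℕ) hts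
  rw [rankChains.grade_apply hc (Finset.mem_Ioo.1 (hS hs)).2.le,
    rankChains.grade_apply hc' (Finset.mem_Ioo.1 (hS ht)).2.le] at h2
  rw [← hts, h2]

/-- The flag numbers of a graded poset count maximal chains: every chain is represented by the
lexicographically first maximal chain through it. -/
theorem flagNumber_eq_card [Finite P] {e : P → ℕ} (he : Function.Injective e) {S : Finset ℕ}
    (hS : S ⊆ Finset.Ioo 0 (grade ℕ (⊤ : P))) :
    flagNumber P S = Nat.card {c // c ∈ rankChains P ∧ Blocks (improvable e c) S} := by
  classical
  refine (Nat.card_eq_of_bijective (fun c => ⟨S.image c.1,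
    rankChains.isChain_image c.2.1 S, image_grade_image c.2.1 hS⟩) ⟨?_, ?_⟩).symm
  · rintro ⟨c, hc, hb⟩ ⟨c', hc', hb'⟩ h
    have himg : S.image c = S.image c' := congrArg Subtype.val h
    rw [blocks_improvable_iff he hc] at hb
    rw [blocks_improvable_iff he hc'] at hb'
    have hcode := le_antisymm (hb c' hc' fun s hs => (apply_eq_of_image_eq hc hc' hS himg hs).symm)
      (hb' c hc fun s hs => apply_eq_of_image_eq hc hc' hS himg hs)
    refine Subtype.ext (funext fun i => he ?_)
    exact congrFun (toLex_inj.1 hcode) i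
  · rintro ⟨C, hC, hCS⟩
    have hne : {c | c ∈ rankChains P ∧ S.image c = C}.Nonempty := by
      obtain ⟨c, hc, hx⟩ := exists_rankChain_of_isChain hC
      refine ⟨c, hc, ?_⟩
      rw [← hCS, Finset.image_image]
      conv_rhs => rw [← Finset.image_id (s := C)]
      exact Finset.image_congr fun x hxC => hx x hxC
    obtain ⟨c, ⟨hc, hcC⟩, hmin⟩ := Set.exists_min_image _ (chainCode e)
      (finite_rankChains.subset fun c (hc : c ∈ rankChains P ∧ S.image c = C) => hc.1) hne
    refine ⟨⟨c, hc, (blocks_improvable_iff he hc).2 fun c' hc' hag => hmin c' ⟨hc', ?_⟩⟩,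
      Subtype.ext hcC⟩
    rw [← hcC]
    exact Finset.image_congr hag

end RankChains

theorem evalAt_apply (P : Type) [PartialOrder P] [BoundedOrder P] [GradeMinOrder ℕ P]
    (F : FlagRing) : evalAt P F = ∑ p ∈ F.coeff.support,
      F.coeff p * if grade ℕ (⊤ : P) = p.rank then (flagNumber P p.set : ℝ) else 0 :=
  linExt_apply _ F

/-- By `flagNumber_eq_card`, exchanging the sums over sets and maximal chains writes the value at P
as a sum of block functionals. -/
theorem evalAt_nonneg {n : ℕ} {F : FlagRing} (hF : F ∈ nonnegForms n) (P : Type) [Finite P]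
    [PartialOrder P] [BoundedOrder P] [GradeMinOrder ℕ P] : 0 ≤ evalAt P F := by
  classical
  rw [evalAt_apply]
  by_cases hn : grade ℕ (⊤ : P) = n
  · subst hn
    obtain ⟨e, he⟩ := Countable.exists_injective_nat P
    have hfin : (rankChains P).Finite := finite_rankChains
    have hcard : ∀ p ∈ F.coeff.support, (flagNumber P p.set : ℝ) =
        ∑ c ∈ hfin.toFinset, if Blocks (improvable e c) p.set then 1 else 0 := by
      intro p hp
      have hr := mem_forms_iff.1 hF.1 p hp
      rw [flagNumber_eq_card he (hr ▸ p.set_subset), Finset.sum_boole]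
      exact congrArg _ (Nat.subtype_card _ fun c => by simp)
    have hsum : ∑ p ∈ F.coeff.support, F.coeff p *
        (if grade ℕ (⊤ : P) = p.rank then (flagNumber P p.set : ℝ) else 0) =
        ∑ c ∈ hfin.toFinset, blockEval (improvable e c) F := by
      simp_rw [blockEval_apply]
      rw [Finset.sum_comm]
      refine Finset.sum_congr rfl fun p hp => ?_
      rw [if_pos (mem_forms_iff.1 hF.1 p hp).symm, hcard p hp, Finset.mul_sum]
      simp
    rw [hsum]
    exact Finset.sum_nonneg fun c _ => hF.2 _ (improvable_mem_systems e c)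
  · refine (Finset.sum_eq_zero fun p hp => ?_).ge
    rw [if_neg fun h => hn (h.trans (mem_forms_iff.1 hF.1 p hp)), mul_zero]

/-! ### Posets realizing the block functionals -/

/-- A graded poset of rank `n` attached to an interval system: the elements of rank `r` carry one of
`N + 1` labels for every interval containing `r`, and comparable elements have the same label for
each interval containing both ranks. -/
@[ext]
structure IntervalPoset {n : ℕ} {I : Finset (ℕ × ℕ)} (hI : I ∈ systems n) (N : ℕ) where
  rk : ℕ
  lab : I → Fin (N + 1)
  rk_le : rk ≤ n
  lab_eq : ∀ q : I, ¬ (q.1.1 < rk ∧ rk < q.1.2) → lab q = 0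

namespace IntervalPoset

variable {n : ℕ} {I : Finset (ℕ × ℕ)} {hI : I ∈ systems n} {N : ℕ}

instance : Finite (IntervalPoset hI N) :=
  Finite.of_injective (β := Fin (n + 1) × (I → Fin (N + 1)))
    (fun x => (⟨x.rk, Nat.lt_succ_of_le x.rk_le⟩, x.lab)) fun x y h => by
      simp only [Prod.mk.injEq, Fin.mk.injEq] at h
      exact IntervalPoset.ext h.1 h.2

instance : PartialOrder (IntervalPoset hI N) where
  le x y := x.rk ≤ y.rk ∧ ∀ q : I, q.1.1 < x.rk → y.rk < q.1.2 → x.lab q = y.lab q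
  le_refl x := ⟨le_rfl, fun _ _ _ => rfl⟩
  le_trans x y z hxy hyz := ⟨hxy.1.trans hyz.1, fun q h1 h2 =>
    (hxy.2 q h1 (hyz.1.trans_lt h2)).trans (hyz.2 q (h1.trans_le hxy.1) h2)⟩
  le_antisymm x y hxy hyx := by
    have hr := le_antisymm hxy.1 hyx.1
    refine IntervalPoset.ext hr (funext fun q => ?_)
    by_cases h : q.1.1 < x.rk ∧ x.rk < q.1.2
    · exact hxy.2 q h.1 (hr ▸ h.2)
    · rw [x.lab_eq q h, y.lab_eq q (hr ▸ h)]

instance : BoundedOrder (IntervalPoset hI N) where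
  bot := ⟨0, fun _ => 0, Nat.zero_le _, fun _ _ => rfl⟩
  bot_le _ := ⟨Nat.zero_le _, fun _ h => absurd h (Nat.not_lt_zero _)⟩
  top := ⟨n, fun _ => 0, le_rfl, fun _ _ => rfl⟩
  le_top x := ⟨x.rk_le, fun q _ h => absurd (mem_systems.1 hI q.1 q.2).2 (not_le.2 h)⟩

theorem rk_lt {x y : IntervalPoset hI N} (h : x < y) : x.rk < y.rk := by
  refine lt_of_le_of_ne h.le.1 fun hr => h.not_ge ⟨hr.ge, fun q h1 h2 => ?_⟩
  exact (h.le.2 q (hr ▸ h1) (hr ▸ h2)).symm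

/-- Give z the rank after that of x, with the label of x on intervals whose left end is below the
rank of x and the label of y on those starting at that rank. -/
theorem exists_between {x y : IntervalPoset hI N} (hxy : x ≤ y) (h : x.rk + 1 < y.rk) :
    ∃ z, x < z ∧ z < y := by
  have hlt : ∀ {u v : IntervalPoset hI N}, u ≤ v → u.rk < v.rk → u < v := fun h1 h2 =>
    lt_of_le_of_ne h1 fun h3 => h2.ne (congrArg rk h3)
  refine ⟨⟨x.rk + 1, fun q => if q.1.1 < x.rk + 1 ∧ x.rk + 1 < q.1.2 then
    (if q.1.1 < x.rk then x.lab q else y.lab q) else 0, h.le.trans y.rk_le, fun q hq => if_neg hq⟩,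
    hlt ⟨Nat.le_succ _, fun q h1 h2 => ?_⟩ (Nat.lt_succ_self _), hlt ⟨h.le, fun q h1 h2 => ?_⟩ h⟩
  · dsimp only at h2 ⊢
    rw [if_pos ⟨by omega, h2⟩, if_pos h1]
  · dsimp only at h1 ⊢
    rw [if_pos ⟨h1, by omega⟩]
    split_ifs with h3
    · exact hxy.2 q h3 h2
    · rfl

instance : GradeMinOrder ℕ (IntervalPoset hI N) where
  grade := rk
  grade_strictMono _ _ h := rk_lt h
  covBy_grade x y h := by
    rw [Nat.covBy_iff_add_one_eq]
    have h1 := rk_lt h.1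
    by_contra hne
    obtain ⟨z, hz1, hz2⟩ := exists_between h.1.le (by omega)
    exact h.2 hz1 hz2
  isMin_grade x h := by
    rw [h.eq_bot]
    exact isMin_bot

theorem grade_eq (x : IntervalPoset hI N) : grade ℕ x = x.rk := rfl

theorem grade_top_eq : grade ℕ (⊤ : IntervalPoset hI N) = n := rfl

/-- The element of rank `min s n` with labels given by `g`. -/
def elt (hI : I ∈ systems n) (g : I → Fin (N + 1)) (s : ℕ) : IntervalPoset hI N where
  rk := min s n
  lab q := if q.1.1 < min s n ∧ min s n < q.1.2 then g q else 0
  rk_le := min_le_right _ _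
  lab_eq _ h := if_neg h

theorem isChain_elt (g : I → Fin (N + 1)) (S : Set ℕ) : IsChain (· ≤ ·) (elt hI g '' S) := by
  have key : ∀ s t, s ≤ t → elt hI g s ≤ elt hI g t := fun s t hst => by
    have h : min s n ≤ min t n := min_le_min_right _ hst
    refine ⟨h, fun q h1 h2 => ?_⟩
    dsimp only [elt] at h1 h2 ⊢
    rw [if_pos ⟨h1, h.trans_lt h2⟩, if_pos ⟨h1.trans_le h, h2⟩]
  rintro _ ⟨s, -, rfl⟩ _ ⟨t, -, rfl⟩ -
  exact (le_total s t).imp (key s t) (key t s)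

/-- Along a chain the label for an interval is constant on the ranks inside it, so a chain with rank
set S amounts to one free label for each interval met by S. Labels of the other intervals are
normalized to 0. -/
theorem flagNumber_eq {S : Finset ℕ} (hS : S ⊆ Finset.Ioo 0 n)
    [DecidablePred fun q : I => ∃ s ∈ S, q.1.1 < s ∧ s < q.1.2] :
    flagNumber (IntervalPoset hI N) S =
      (N + 1) ^ (Finset.univ.filter fun q : I => ∃ s ∈ S, q.1.1 < s ∧ s < q.1.2).card := by
  classical
  let met : I → Prop := fun q => ∃ s ∈ S, q.1.1 < s ∧ s < q.1.2
  let T : Finset (I → Fin (N + 1)) :=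
    Fintype.piFinset fun q => if met q then Finset.univ else {0}
  have hT : T.card = (N + 1) ^ (Finset.univ.filter fun q : I => met q).card := by
    rw [Fintype.card_piFinset, ← Finset.prod_const, Finset.prod_filter]
    refine Finset.prod_congr rfl fun q _ => ?_
    by_cases h : met q <;> simp [h]
  have hmemT : ∀ g, g ∈ T ↔ ∀ q, ¬ met q → g q = 0 := fun g => by
    rw [Fintype.mem_piFinset]
    refine forall_congr' fun q => ?_
    by_cases h : met q <;> simp [h]
  have hmin : ∀ s ∈ S, min s n = s := fun s hs => min_eq_left (Finset.mem_Ioo.1 (hS hs)).2.le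
  refine Eq.trans ?_ (hT.trans (by congr!))
  rw [← Fintype.card_coe T, ← Nat.card_eq_fintype_card]
  have himage : ∀ g : I → Fin (N + 1), (S.image (elt hI g)).image (grade ℕ) = S := fun g => by
    rw [Finset.image_image]
    conv_rhs => rw [← Finset.image_id (s := S)]
    exact Finset.image_congr fun s hs => hmin s hs
  have hchain : ∀ g : I → Fin (N + 1),
      IsChain (· ≤ ·) ((S.image (elt hI g) : Finset (IntervalPoset hI N)) : Set (IntervalPoset hI N)) := fun g => by
    rw [Finset.coe_image]
    exact isChain_elt _ _
  refine (Nat.card_eq_of_bijective (fun g : T => ⟨S.image (elt hI g.1), hchain g.1, himage g.1⟩)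
    ⟨?_, ?_⟩).symm
  · rintro ⟨g, hg⟩ ⟨g', hg'⟩ h
    have himg : S.image (elt hI g) = S.image (elt hI g') := congrArg Subtype.val h
    refine Subtype.ext (funext fun q => ?_)
    dsimp only
    by_cases hq : met q
    · obtain ⟨s, hs, h1, h2⟩ := hq
      obtain ⟨t, ht, hts⟩ := Finset.mem_image.1 (himg ▸ Finset.mem_image_of_mem (elt hI g) hs)
      have hr : min t n = min s n := congrArg rk hts
      rw [hmin t ht, hmin s hs] at hr
      subst hr
      have hl := congrFun (congrArg lab hts) q
      dsimp only [elt] at hl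
      rw [hmin t ht, if_pos ⟨h1, h2⟩, if_pos ⟨h1, h2⟩] at hl
      exact hl.symm
    · rw [(hmemT g).1 hg q hq, (hmemT g').1 hg' q hq]
  · rintro ⟨C, hC, hCS⟩
    have hex : ∀ q, met q → ∃ x ∈ C, q.1.1 < x.rk ∧ x.rk < q.1.2 := fun q ⟨s, hs, h⟩ => by
      rw [← hCS] at hs
      obtain ⟨x, hx, rfl⟩ := Finset.mem_image.1 hs
      exact ⟨x, hx, h⟩
    let g : I → Fin (N + 1) := fun q => if h : met q then (hex q h).choose.lab q else 0
    have hel : ∀ x ∈ C, elt hI g x.rk = x := fun x hx => by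
      refine IntervalPoset.ext (min_eq_left x.rk_le) (funext fun q => ?_)
      dsimp only [elt]
      rw [min_eq_left x.rk_le]
      split_ifs with hq
      · have hmet : met q := ⟨x.rk, hCS ▸ Finset.mem_image_of_mem (grade ℕ) hx, hq⟩
        obtain ⟨hy, h1, h2⟩ := (hex q hmet).choose_spec
        rw [show g q = (hex q hmet).choose.lab q from dif_pos hmet]
        rcases hC.total hy hx with h | h
        · exact h.2 q h1 hq.2
        · exact (h.2 q hq.1 h2).symm
      · exact (x.lab_eq q hq).symm
    refine ⟨⟨g, (hmemT g).2 fun q hq => dif_neg hq⟩, Subtype.ext ?_⟩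
    dsimp only
    rw [← hCS, Finset.image_image]
    conv_rhs => rw [← Finset.image_id (s := C)]
    exact Finset.image_congr fun x hx => hel x hx

end IntervalPoset

-- After division by (N + 1)^|I|, the coefficient at S is weighted by (N + 1)^(-d S), where d S
-- counts the intervals missed by S. In the limit only the sets meeting all intervals remain.
open Filter Topology in
theorem blockEval_nonneg_of_mem_cone {n : ℕ} (hn : 1 ≤ n) {F : FlagRing} (hF : F ∈ cone n)
    {I : Finset (ℕ × ℕ)} (hI : I ∈ systems n) : 0 ≤ blockEval I F := by
  classical
  let d : Finset ℕ → ℕ := fun S =>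
    (Finset.univ.filter fun q : I => ¬ ∃ s ∈ S, q.1.1 < s ∧ s < q.1.2).card
  have hd : ∀ S, d S = 0 ↔ Blocks I S := fun S => by
    simp [d, Finset.filter_eq_empty_iff, Blocks]
  have heval : ∀ N : ℕ, evalAt (IntervalPoset hI N) F * (1 / ((N : ℝ) + 1)) ^ I.card =
      ∑ p ∈ F.coeff.support, F.coeff p * (1 / ((N : ℝ) + 1)) ^ d p.set := fun N => by
    rw [evalAt_apply, Finset.sum_mul]
    refine Finset.sum_congr rfl fun p hp => ?_
    have hr := mem_forms_iff.1 hF.1 p hp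
    rw [if_pos (IntervalPoset.grade_top_eq.trans hr.symm), mul_assoc,
      IntervalPoset.flagNumber_eq (hr ▸ p.set_subset)]
    congr 1
    have hcard := Finset.card_filter_add_card_filter_not (s := (Finset.univ : Finset I))
      (fun q : I => ∃ s ∈ p.set, q.1.1 < s ∧ s < q.1.2)
    rw [Finset.card_univ, Fintype.card_coe] at hcard
    rw [← hcard, pow_add, ← mul_assoc]
    push_cast
    rw [← mul_pow, mul_one_div_cancel (by positivity), one_pow, one_mul]
  have hlim : Tendsto (fun N : ℕ => ∑ p ∈ F.coeff.support,
      F.coeff p * (1 / ((N : ℝ) + 1)) ^ d p.set) atTop (𝓝 (blockEval I F)) := by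
    rw [blockEval_apply]
    refine tendsto_finsetSum _ fun p _ => ?_
    have h1 := ((tendsto_one_div_add_atTop_nhds_zero_nat (𝕜 := ℝ)).pow (d p.set)).const_mul
      (F.coeff p)
    convert h1 using 2
    by_cases h : Blocks I p.set
    · simp [h, (hd p.set).2 h]
    · rw [if_neg h, zero_pow (fun h' => h ((hd _).1 h')), mul_zero]
  refine ge_of_tendsto' hlim fun N => ?_
  rw [← heval]
  exact mul_nonneg (hF.2 _ hn) (by positivity)

theorem cone_eq_nonnegForms {n : ℕ} (hn : 1 ≤ n) : cone n = nonnegForms n :=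
  Set.Subset.antisymm (fun _ hF => ⟨hF.1, fun _ hI => blockEval_nonneg_of_mem_cone hn hF hI⟩)
    fun _ hF => ⟨hF.1, fun P _ _ _ _ _ => evalAt_nonneg hF P⟩

/-! ### Degree zero and the criterion for two factors -/

theorem one_eq_fEmpty : (1 : FlagRing) = fEmpty 0 := rfl

theorem nonnegForms_subset_cone (n : ℕ) : nonnegForms n ⊆ cone n :=
  fun _ hF => ⟨hF.1, fun P _ _ _ _ _ => evalAt_nonneg hF P⟩

theorem eq_smul_fEmpty_of_support {n : ℕ} {F : FlagRing} (hF : F ∈ forms n)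
    (h : ∀ p ∈ F.coeff.support, p.set = ∅) : ∃ c : ℝ, F = c • fEmpty n := by
  refine ⟨∑ p ∈ F.coeff.support, F.coeff p, ?_⟩
  rw [Finset.sum_smul, ← linExt_apply (fun _ => fEmpty n)]
  conv_lhs => rw [← linExt_chainOp_self F]
  refine linExt_congr fun p hp => congrArg chainOp (ChainOp.ext ?_ (h p hp))
  exact mem_forms_iff.1 hF p hp

theorem eq_smul_one_of_mem_forms_zero {F : FlagRing} (hF : F ∈ forms 0) :
    ∃ c : ℝ, F = c • (1 : FlagRing) :=
  eq_smul_fEmpty_of_support hF fun p hp => by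
    have := p.set_subset
    rw [mem_forms_iff.1 hF p hp] at this
    simpa using this

/-- No tested poset has rank 0, so the cone of degree 0 is a whole line, and F = 2F + (-F)
contradicts extremality. -/
theorem one_le_of_isExtremeRay_cone {m : ℕ} {F : FlagRing} (h : IsExtremeRay (cone m) F) :
    1 ≤ m := by
  rcases Nat.eq_zero_or_pos m with rfl | hm
  · exfalso
    obtain ⟨hF, h0, hext⟩ := h
    have hall : ∀ G ∈ forms 0, G ∈ cone 0 := fun G hG => by
      refine ⟨hG, fun P _ _ _ _ hP => ?_⟩
      rw [evalAt_apply]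
      refine (Finset.sum_eq_zero fun p hp => ?_).ge
      rw [mem_forms_iff.1 hG p hp, if_neg (by omega), mul_zero]
    obtain ⟨-, t, ht, h1⟩ := hext _ (hall _ (Submodule.smul_mem _ (2 : ℝ) hF.1)) _
      (hall _ (Submodule.smul_mem _ (-1 : ℝ) hF.1)) (by module)
    have h2 : (t + 1) • F = 0 := by
      rw [add_smul, ← h1]
      module
    rcases smul_eq_zero.1 h2 with h3 | h3
    · linarith
    · exact h0 h3
  · exact hm

/-- The empty set meets only the empty system, and that system is met by every set. -/
theorem fEmpty_mul_fEmpty_sub_mem {k l : ℕ} :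
    fEmpty k * fEmpty l - fEmpty (k + l) ∈ nonnegForms (k + l) := by
  refine ⟨Submodule.sub_mem _ (mul_mem_forms (fEmpty_mem_forms k) (fEmpty_mem_forms l))
    (fEmpty_mem_forms _), fun I _ => ?_⟩
  rw [map_sub, sub_nonneg]
  by_cases h : Blocks I (ChainOp.empty (k + l)).set
  · have h' : Blocks I (ChainOp.empty k * ChainOp.empty l).set := fun q hq => by
      obtain ⟨s, hs, -⟩ := h q hq
      exact absurd hs (Finset.notMem_empty s)
    rw [fEmpty, fEmpty, fEmpty, chainOp_mul]
    exact ((condEval_chainOp_of h).trans (condEval_chainOp_of h').symm).le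
  · exact (condEval_chainOp_of_not h).trans_le
      ((mul_mem_nonnegForms (fEmpty_mem_nonnegForms k) (fEmpty_mem_nonnegForms l)).2 I ‹_›)

theorem not_isExtremeRay_mul_fEmpty_mul {a b k l : ℕ} (hk : 0 < k) (hl : 0 < l) {A B : FlagRing}
    (hA : A ∈ nonnegForms a) (hB : B ∈ nonnegForms b) (hA0 : A ≠ 0) (hB0 : B ≠ 0) :
    ¬ IsExtremeRay (nonnegForms (a + k + (l + b))) (A * fEmpty k * (fEmpty l * B)) := by
  rw [show a + k + (l + b) = a + (k + l) + b by omega]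
  rintro ⟨-, -, hext⟩
  have hf := fEmpty_mem_forms (k + l)
  have hff := mul_mem_forms (fEmpty_mem_forms k) (fEmpty_mem_forms l)
  obtain ⟨⟨t, -, ht⟩, -⟩ := hext (A * fEmpty (k + l) * B)
    (mul_mem_nonnegForms (mul_mem_nonnegForms hA (fEmpty_mem_nonnegForms _)) hB)
    (A * (fEmpty k * fEmpty l - fEmpty (k + l)) * B)
    (mul_mem_nonnegForms (mul_mem_nonnegForms hA fEmpty_mul_fEmpty_sub_mem) hB)
    (by noncomm_ring)
  obtain ⟨L, hL, hLA⟩ := exists_blockEval_pos hA hA0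
  obtain ⟨R, hR, hRB⟩ := exists_blockEval_pos hB hB0
  -- The point interval at k kills the summand with f_∅^(k+l) but not the product, so that summand
  -- could only be the zero multiple.
  have hM : {(k - 1, k + 1)} ∈ systems (k + l) := singleton_mem_systems (by omega) (by omega)
  have hLM := union_mem_systems (le_mem_systems (Nat.le_add_right a (k + l)) hL)
    (shift_mem_systems (m := a) hM)
  have h0 : blockEval {(k - 1, k + 1)} (fEmpty (k + l)) = 0 := condEval_chainOp_of_not fun h => by
    obtain ⟨s, hs, -⟩ := blocks_singleton.1 h
    exact absurd hs (Finset.notMem_empty s)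
  have h1 : blockEval {(k - 1, k + 1)} (fEmpty k * fEmpty l) = 1 := by
    rw [fEmpty, fEmpty, chainOp_mul]
    refine condEval_chainOp_of (blocks_singleton.2 ⟨k, ?_, by omega, by omega⟩)
    rw [ChainOp.mem_mul_set]
    exact Or.inr (Or.inl ⟨rfl, hk, hl⟩)
  have e := congrArg (blockEval (L ∪ shift a {(k - 1, k + 1)} ∪ shift (a + (k + l)) R)) ht
  rw [show A * fEmpty k * (fEmpty l * B) = A * (fEmpty k * fEmpty l) * B by simp only [mul_assoc],
    map_smul, blockEval_mul (mul_mem_forms hA.1 hf) hB.1 hLM hR,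
    blockEval_mul (mul_mem_forms hA.1 hff) hB.1 hLM hR, blockEval_mul hA.1 hf hL hM,
    blockEval_mul hA.1 hff hL hM, h0, h1, mul_zero, zero_mul, mul_one, smul_eq_mul] at e
  have ht0 : t = 0 := by
    rcases mul_eq_zero.1 e.symm with h | h
    · exact h
    · exact absurd h (mul_pos hLA hRB).ne'
  rw [ht0, zero_smul] at ht
  exact form_mul_ne_zero (mul_mem_forms hA.1 hf) hB.1
    (form_mul_ne_zero hA.1 hf hA0 (fEmpty_ne_zero _)) hB0 ht

theorem mem_nonnegForms_of_mul_fEmpty {m k : ℕ} {F F' : FlagRing} (hkm : k ≤ m)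
    (hF : F ∈ nonnegForms m) (hF' : F' ∈ forms (m - k)) (h : F = F' * fEmpty k) :
    F' ∈ nonnegForms (m - k) := by
  refine mem_nonnegForms_of_mul_left hF' (fEmpty_mem_forms k) ?_ (empty_mem_systems k)
    (blockEval_empty_fEmpty k ▸ one_pos)
  rwa [← h, Nat.sub_add_cancel hkm]

theorem mem_nonnegForms_of_fEmpty_mul {n l : ℕ} {G G' : FlagRing} (hln : l ≤ n)
    (hG : G ∈ nonnegForms n) (hG' : G' ∈ forms (n - l)) (h : G = fEmpty l * G') :
    G' ∈ nonnegForms (n - l) := by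
  refine mem_nonnegForms_of_mul_right (fEmpty_mem_forms l) hG' ?_ (empty_mem_systems l)
    (blockEval_empty_fEmpty l ▸ one_pos)
  rwa [← h, Nat.add_sub_cancel' hln]

/-- The product of two extreme rays is extreme unless the factors can be divided by some `f_∅` on
the inner side. -/
theorem isExtremeRay_mul_iff {m n : ℕ} (hm : 0 < m) (hn : 0 < n) {F G : FlagRing}
    (hF : IsExtremeRay (nonnegForms m) F) (hG : IsExtremeRay (nonnegForms n) G) :
    IsExtremeRay (nonnegForms (m + n)) (F * G) ↔
      ¬ ∃ (k l : ℕ) (F' G' : FlagRing), 1 ≤ k ∧ k ≤ m ∧ 1 ≤ l ∧ l ≤ n ∧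
        F' ∈ forms (m - k) ∧ G' ∈ forms (n - l) ∧ F = F' * fEmpty k ∧ G = fEmpty l * G' := by
  constructor
  · rintro h ⟨k, l, F', G', hk, hkm, hl, hln, hF', hG', hFF', hGG'⟩
    have h1 := mem_nonnegForms_of_mul_fEmpty hkm hF.1 hF' hFF'
    have h2 := mem_nonnegForms_of_fEmpty_mul hln hG.1 hG' hGG'
    have hF0 : F' ≠ 0 := fun h0 => hF.2.1 (by rw [hFF', h0, zero_mul])
    have hG0 : G' ≠ 0 := fun h0 => hG.2.1 (by rw [hGG', h0, mul_zero])
    refine not_isExtremeRay_mul_fEmpty_mul hk hl h1 h2 hF0 hG0 ?_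
    rwa [Nat.sub_add_cancel hkm, Nat.add_sub_cancel' hln, ← hFF', ← hGG']
  · intro h
    exact isExtremeRay_of_vanish (mul_mem_nonnegForms hF.1 hG.1)
      (form_mul_ne_zero hF.1.1 hG.1.1 hF.2.1 hG.2.1)
      fun E hE => eq_smul_mul_of_vanish hm hn hF hG h hE

theorem eq_of_mul_right_eq_smul {m n : ℕ} {F G X : FlagRing} {t : ℝ} (hF : F ∈ forms m)
    (hG : G ∈ forms m) (hX : X ∈ forms n) (hX0 : X ≠ 0) (h : G * X = t • (F * X)) : G = t • F := by
  by_contra hne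
  refine form_mul_ne_zero (Submodule.sub_mem _ hG (Submodule.smul_mem _ t hF)) hX
    (sub_ne_zero.2 hne) hX0 ?_
  rw [sub_mul, smul_mul_assoc, h, sub_self]

theorem eq_of_mul_left_eq_smul {m n : ℕ} {F G X : FlagRing} {t : ℝ} (hF : F ∈ forms m)
    (hG : G ∈ forms m) (hX : X ∈ forms n) (hX0 : X ≠ 0) (h : X * G = t • (X * F)) : G = t • F := by
  by_contra hne
  refine form_mul_ne_zero hX (Submodule.sub_mem _ hG (Submodule.smul_mem _ t hF)) hX0
    (sub_ne_zero.2 hne) ?_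
  rw [mul_sub, mul_smul_comm, h, sub_self]

/-- Multiply a decomposition of F by X, use extremality of F * X, and cancel X. -/
theorem IsExtremeRay.of_mul_left {m n : ℕ} {F X : FlagRing} (hF : F ∈ nonnegForms m)
    (hX : X ∈ nonnegForms n) (h : IsExtremeRay (nonnegForms (m + n)) (F * X)) :
    IsExtremeRay (nonnegForms m) F := by
  have hF0 : F ≠ 0 := fun h0 => h.2.1 (by rw [h0, zero_mul])
  have hX0 : X ≠ 0 := fun h0 => h.2.1 (by rw [h0, mul_zero])
  refine ⟨hF, hF0, fun G hG H hH hGH => ?_⟩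
  obtain ⟨⟨s, hs, h1⟩, ⟨t, ht, h2⟩⟩ := h.2.2 (G * X) (mul_mem_nonnegForms hG hX) (H * X)
    (mul_mem_nonnegForms hH hX) (by rw [hGH, add_mul])
  exact ⟨⟨s, hs, eq_of_mul_right_eq_smul hF.1 hG.1 hX.1 hX0 h1⟩,
    ⟨t, ht, eq_of_mul_right_eq_smul hF.1 hH.1 hX.1 hX0 h2⟩⟩

theorem IsExtremeRay.of_mul_right {m n : ℕ} {F X : FlagRing} (hX : X ∈ nonnegForms m)
    (hF : F ∈ nonnegForms n) (h : IsExtremeRay (nonnegForms (m + n)) (X * F)) :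
    IsExtremeRay (nonnegForms n) F := by
  have hF0 : F ≠ 0 := fun h0 => h.2.1 (by rw [h0, mul_zero])
  have hX0 : X ≠ 0 := fun h0 => h.2.1 (by rw [h0, zero_mul])
  refine ⟨hF, hF0, fun G hG H hH hGH => ?_⟩
  obtain ⟨⟨s, hs, h1⟩, ⟨t, ht, h2⟩⟩ := h.2.2 (X * G) (mul_mem_nonnegForms hX hG) (X * H)
    (mul_mem_nonnegForms hX hH) (by rw [hGH, mul_add])
  exact ⟨⟨s, hs, eq_of_mul_left_eq_smul hF.1 hG.1 hX.1 hX0 h1⟩,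
    ⟨t, ht, eq_of_mul_left_eq_smul hF.1 hH.1 hX.1 hX0 h2⟩⟩

/-! ### Indecomposable factors -/

theorem ChainOp.mul_eq_mul_iff {p q p' q' : ChainOp} (hr : p'.rank = p.rank) :
    p' * q' = p * q ↔ p' = p ∧ q' = q := by
  refine ⟨fun h => ?_, fun h => by rw [h.1, h.2]⟩
  have hr' : q'.rank = q.rank := by
    have := congrArg ChainOp.rank h
    rw [ChainOp.mul_rank, ChainOp.mul_rank] at this
    omega
  have hmem : ∀ i, i ∈ (p' * q').set ↔ i ∈ (p * q).set := fun i => by rw [h]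
  simp only [ChainOp.mem_mul_set, hr, hr'] at hmem
  have key : ∀ {p q p' q' : ChainOp}, p'.rank = p.rank → (∀ i,
      i ∈ p'.set ∨ (i = p.rank ∧ 0 < p.rank ∧ 0 < q.rank) ∨ (∃ t ∈ q'.set, t + p.rank = i) →
      i ∈ p.set ∨ (i = p.rank ∧ 0 < p.rank ∧ 0 < q.rank) ∨ ∃ t ∈ q.set, t + p.rank = i) →
      p'.set ⊆ p.set ∧ q'.set ⊆ q.set := by
    intro p q p' q' hr h
    refine ⟨fun i hi => ?_, fun t ht => ?_⟩
    · have := Finset.mem_Ioo.1 (p'.set_subset hi)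
      rcases h i (Or.inl hi) with h1 | h1 | ⟨t, _, h1⟩
      · exact h1
      · omega
      · omega
    · have := Finset.mem_Ioo.1 (q'.set_subset ht)
      rcases h _ (Or.inr (Or.inr ⟨t, ht, rfl⟩)) with h1 | h1 | ⟨s, hs, h1⟩
      · have := Finset.mem_Ioo.1 (p.set_subset h1)
        omega
      · omega
      · obtain rfl : s = t := by omega
        exact hs
  have h1 := key hr fun i => (hmem i).1
  have h2 := key (p := p') (q := q') (p' := p) (q' := q) hr.symm fun i => by
    rw [hr, hr']
    exact (hmem i).2
  exact ⟨ChainOp.ext hr (h1.1.antisymm h2.1), ChainOp.ext hr' (h1.2.antisymm h2.2)⟩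

/-- No cancellation occurs: the rank of the left factor being fixed, a product symbol determines
both of its factors. -/
theorem mul_mem_support_mul {m : ℕ} {F G : FlagRing} (hF : F ∈ forms m)
    {p q : ChainOp} (hp : p ∈ F.coeff.support) (hq : q ∈ G.coeff.support) :
    p * q ∈ (F * G).coeff.support := by
  have hr := mem_forms_iff.1 hF
  rw [Finsupp.mem_support_iff, MonoidAlgebra.coeff_mul_mul_of_uniqueMul]
  · exact mul_ne_zero (Finsupp.mem_support_iff.1 hp) (Finsupp.mem_support_iff.1 hq)
  · intro p' q' hp' _ h
    exact (ChainOp.mul_eq_mul_iff ((hr p' hp').trans (hr p hp).symm)).1 h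

/-- An indecomposable form that is divisible by some `f_∅` from the right is a multiple of `f_∅`. -/
theorem IsIndecomposable.eq_smul_of_eq_mul_fEmpty {n k : ℕ} {F F' : FlagRing}
    (hF : IsIndecomposable n F) (hk : 1 ≤ k) (hkn : k ≤ n) (hF' : F' ∈ forms (n - k))
    (h : F = F' * fEmpty k) : ∃ c : ℝ, F = c • fEmpty n := by
  rcases hkn.eq_or_lt with rfl | hlt
  · rw [Nat.sub_self] at hF'
    obtain ⟨c, rfl⟩ := eq_smul_one_of_mem_forms_zero hF'
    exact ⟨c, by rw [h, smul_mul_assoc, one_mul]⟩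
  · exact absurd h (hF.2.2.2 _ (by omega) _ hlt _ hF' _ (fEmpty_mem_forms k))

/-- An indecomposable left factor of a form divisible by some `f_∅` from the left is a multiple
of `f_∅`. -/
theorem IsIndecomposable.eq_smul_of_mul_eq_fEmpty_mul {n a l : ℕ} {F A G' : FlagRing}
    (hF : IsIndecomposable n F) (hA0 : A ≠ 0) (hl : 1 ≤ l) (hln : l ≤ n + a)
    (hG' : G' ∈ forms (n + a - l)) (h : F * A = fEmpty l * G') : ∃ c : ℝ, F = c • fEmpty n := by
  classical
  obtain ⟨p, hp⟩ : A.coeff.support.Nonempty := by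
    rw [Finsupp.support_nonempty_iff]
    simpa using hA0
  -- Each q * p survives in F * A, hence is the symbol of f_∅^l times another symbol; below rank n
  -- its set is that of q.
  have hset : ∀ q ∈ F.coeff.support, (∀ s ∈ q.set, l ≤ s) ∧ (l < n → l ∈ q.set) := by
    intro q hq
    have hqr := mem_forms_iff.1 hF.2.1 q hq
    have hmem := mul_mem_support_mul hF.2.1 hq hp
    rw [h] at hmem
    obtain ⟨e, he, r, hr, her⟩ := Finset.mem_mul.1 (MonoidAlgebra.support_coeff_mul_subset _ _ hmem)
    have he' : e = ChainOp.empty l := by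
      have := Finsupp.support_single_subset he
      simpa using this
    subst he'
    have hi : ∀ i, i ∈ (q * p).set ↔ i = l ∧ 0 < l ∧ 0 < r.rank ∨ ∃ t ∈ r.set, t + l = i := by
      intro i
      rw [← her, ChainOp.mem_mul_set]
      simp [ChainOp.empty]
    constructor
    · intro s hs
      have h1 : s ∈ (q * p).set := by
        rw [ChainOp.mem_mul_set]
        exact Or.inl hs
      rcases (hi s).1 h1 with h2 | ⟨t, -, h2⟩ <;> omega
    · intro hlt
      have hrr := mem_forms_iff.1 hG' r hr
      have h1 := (hi l).2 (Or.inl ⟨rfl, by omega, by omega⟩)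
      rw [ChainOp.mem_mul_set] at h1
      rcases h1 with h1 | h1 | ⟨t, -, h1⟩
      · exact h1
      · omega
      · omega
  -- For l < n the form F itself would split off f_∅^l, contradicting indecomposability; for l ≥ n
  -- no element is possible.
  rcases lt_or_ge l n with hlt | hge
  · exact absurd (eq_fEmpty_mul_highSlice hF.2.1 hl hlt.le fun q hq =>
      ⟨(hset q hq).1, Or.inr ((hset q hq).2 hlt)⟩)
      (hF.2.2.2 _ hlt _ (by omega) _ (fEmpty_mem_forms l) _ (highSlice_mem _ _ _ _))
  · refine eq_smul_fEmpty_of_support hF.2.1 fun q hq => Finset.eq_empty_of_forall_notMem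
      fun s hs => ?_
    have h1 := (hset q hq).1 s hs
    have h2 := pos_lt_of_mem_support hF.2.1 hq hs
    omega

theorem prod_mem_nonnegForms : ∀ (r : ℕ) (n : Fin r → ℕ) (F : Fin r → FlagRing),
    (∀ i, F i ∈ nonnegForms (n i)) → (List.ofFn F).prod ∈ nonnegForms (∑ i, n i)
  | 0, n, F, _ => by
    rw [List.ofFn_zero, List.prod_nil, one_eq_fEmpty]
    exact fEmpty_mem_nonnegForms 0
  | r + 1, n, F, h => by
    rw [List.ofFn_succ, List.prod_cons, Fin.sum_univ_succ]
    exact mul_mem_nonnegForms (h 0) (prod_mem_nonnegForms r _ _ fun i => h i.succ)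

theorem prod_form_ne_zero : ∀ (r : ℕ) (n : Fin r → ℕ) (F : Fin r → FlagRing),
    (∀ i, F i ∈ nonnegForms (n i)) → (∀ i, F i ≠ 0) → (List.ofFn F).prod ≠ 0
  | 0, n, F, _, _ => by
    rw [List.ofFn_zero, List.prod_nil, one_eq_fEmpty]
    exact fEmpty_ne_zero 0
  | r + 1, n, F, h, h0 => by
    rw [List.ofFn_succ, List.prod_cons]
    exact form_mul_ne_zero (h 0).1 (prod_mem_nonnegForms r _ _ fun i => h i.succ).1 (h0 0)
      (prod_form_ne_zero r _ _ (fun i => h i.succ) fun i => h0 i.succ)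

/-- A product of indecomposable nonnegative forms is an extreme ray if and only if all factors are,
and no two consecutive ones are multiples of `f_∅`. -/
theorem isExtremeRay_prod_iff : ∀ (r : ℕ) (n : Fin (r + 1) → ℕ) (F : Fin (r + 1) → FlagRing),
    (∀ i, F i ∈ nonnegForms (n i)) → (∀ i, IsIndecomposable (n i) (F i)) →
    (IsExtremeRay (nonnegForms (∑ i, n i)) (List.ofFn F).prod ↔
      (∀ i, IsExtremeRay (nonnegForms (n i)) (F i)) ∧
      ∀ i j : Fin (r + 1), j.val = i.val + 1 →
        ¬ ((∃ c : ℝ, F i = c • fEmpty (n i)) ∧ (∃ c : ℝ, F j = c • fEmpty (n j))))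
  | 0, n, F, _, _ => by
    have h : (List.ofFn F).prod = F 0 := by simp
    rw [h, Fin.sum_univ_one]
    refine ⟨fun h => ⟨fun i => by rwa [Fin.fin_one_eq_zero i], fun i j hij => by omega⟩,
      fun h => h.1 0⟩
  | r + 1, n, F, hF, hind => by
    have ih := isExtremeRay_prod_iff r (fun i => n i.succ) (fun i => F i.succ)
      (fun i => hF i.succ) (fun i => hind i.succ)
    have hQ := prod_mem_nonnegForms (r + 1) (fun i => n i.succ) (fun i => F i.succ)
      (fun i => hF i.succ)
    have hZ := prod_mem_nonnegForms r (fun i => n i.succ.succ) (fun i => F i.succ.succ)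
      (fun i => hF i.succ.succ)
    have hZ0 := prod_form_ne_zero r (fun i => n i.succ.succ) (fun i => F i.succ.succ)
      (fun i => hF i.succ.succ) (fun i => (hind i.succ.succ).2.2.1)
    have hQZ : (List.ofFn fun i : Fin (r + 1) => F i.succ).prod =
        F (Fin.succ 0) * (List.ofFn fun i : Fin r => F i.succ.succ).prod := by
      rw [List.ofFn_succ, List.prod_cons]
    have hsum : ∑ i : Fin (r + 1), n i.succ = n (Fin.succ 0) + ∑ i : Fin r, n i.succ.succ :=
      Fin.sum_univ_succ _
    have hn0 := (hind 0).1
    have hn1 := (hind (Fin.succ 0)).1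
    rw [List.ofFn_succ, List.prod_cons, Fin.sum_univ_succ]
    generalize (List.ofFn fun i : Fin r => F i.succ.succ).prod = Z at *
    generalize (List.ofFn fun i : Fin (r + 1) => F i.succ).prod = Q at *
    generalize ∑ i : Fin r, n i.succ.succ = z at *
    generalize ∑ i : Fin (r + 1), n i.succ = w at *
    constructor
    · intro h
      have h0 := IsExtremeRay.of_mul_left (hF 0) hQ h
      have h1 := IsExtremeRay.of_mul_right (hF 0) hQ h
      obtain ⟨h2, h3⟩ := ih.1 h1
      refine ⟨Fin.cases h0 h2, fun i j hij => ?_⟩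
      induction j using Fin.cases with
      | zero => exact absurd hij (by simp)
      | succ j =>
        induction i using Fin.cases with
        | zero =>
          obtain rfl : j = 0 := by
            ext
            simpa using hij
          rintro ⟨⟨c, hc⟩, ⟨d, hd⟩⟩
          -- The first factor is entirely f_∅ up to a scalar, so its cofactor has degree 0; the
          -- remaining product starts with f_∅ in the full degree of the second factor.
          refine (isExtremeRay_mul_iff hn0 (by omega) h0 h1).1 h ⟨n 0, n (Fin.succ 0), c • 1, d • Z,
            hn0, le_rfl, hn1, by omega, ?_, ?_, ?_, ?_⟩
          · rw [Nat.sub_self, one_eq_fEmpty]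
            exact Submodule.smul_mem _ _ (fEmpty_mem_forms 0)
          · rw [hsum, Nat.add_sub_cancel_left]
            exact Submodule.smul_mem _ _ hZ.1
          · rw [smul_mul_assoc, one_mul, ← hc]
          · rw [hQZ, hd, smul_mul_assoc, mul_smul_comm]
        | succ i => exact h3 i j (by simpa using hij)
    · rintro ⟨h1, h2⟩
      have hQe := ih.2 ⟨fun i => h1 i.succ, fun i j hij => h2 i.succ j.succ (by simpa using hij)⟩
      refine (isExtremeRay_mul_iff hn0 (by omega) (h1 0) hQe).2 ?_
      rintro ⟨k, l, F', G', hk, hkm, hl, hln, hF', hG', hFF', hGG'⟩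
      rw [hsum] at hln hG'
      exact h2 0 (Fin.succ 0) rfl ⟨(hind 0).eq_smul_of_eq_mul_fEmpty hk hkm hF' hFF',
        (hind (Fin.succ 0)).eq_smul_of_mul_eq_fEmpty_mul hZ0 hl hln hG' (hQZ ▸ hGG')⟩

end FlagPoset

end

open FlagPoset in
theorem theorem5p1 :
    (∀ (m n : ℕ) (F G : FlagRing), IsExtremeRay (cone m) F → IsExtremeRay (cone n) G →
      F * G ∈ cone (m + n) ∧
      (IsExtremeRay (cone (m + n)) (F * G) ↔
        ¬ ∃ (k l : ℕ) (F' G' : FlagRing), 1 ≤ k ∧ k ≤ m ∧ 1 ≤ l ∧ l ≤ n ∧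
          F' ∈ cone (m - k) ∧ G' ∈ cone (n - l) ∧
          F = F' * fEmpty k ∧ G = fEmpty l * G')) ∧
    (∀ (r : ℕ) (n : Fin r → ℕ) (F : Fin r → FlagRing), 0 < r →
      (∀ i, F i ∈ cone (n i)) → (∀ i, IsIndecomposable (n i) (F i)) →
      (IsExtremeRay (cone (∑ i, n i)) (List.ofFn F).prod ↔
        (∀ i, IsExtremeRay (cone (n i)) (F i)) ∧
        ∀ i j : Fin r, j.val = i.val + 1 →
          ¬ ((∃ c : ℝ, F i = c • fEmpty (n i)) ∧ (∃ c : ℝ, F j = c • fEmpty (n j))))) := by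
  refine ⟨fun m n F G hF hG => ?_, fun r n F hr hF hind => ?_⟩
  · have hm := one_le_of_isExtremeRay_cone hF
    have hn := one_le_of_isExtremeRay_cone hG
    rw [cone_eq_nonnegForms hm] at hF
    rw [cone_eq_nonnegForms hn] at hG
    rw [cone_eq_nonnegForms (n := m + n) (by omega)]
    refine ⟨mul_mem_nonnegForms hF.1 hG.1, (isExtremeRay_mul_iff hm hn hF hG).trans (not_congr ?_)⟩
    constructor
    · rintro ⟨k, l, F', G', hk, hkm, hl, hln, hF', hG', hFF', hGG'⟩
      exact ⟨k, l, F', G', hk, hkm, hl, hln,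
        nonnegForms_subset_cone _ (mem_nonnegForms_of_mul_fEmpty hkm hF.1 hF' hFF'),
        nonnegForms_subset_cone _ (mem_nonnegForms_of_fEmpty_mul hln hG.1 hG' hGG'), hFF', hGG'⟩
    -- Only homogeneity of the cofactors is used: in degree 0 `cone` contains the negative
    -- constants, while `nonnegForms` does not.
    · rintro ⟨k, l, F', G', hk, hkm, hl, hln, hF', hG', h⟩
      exact ⟨k, l, F', G', hk, hkm, hl, hln, hF'.1, hG'.1, h⟩
  · obtain ⟨r, rfl⟩ := Nat.exists_eq_succ_of_ne_zero hr.ne'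
    have hcone : ∀ i, cone (n i) = nonnegForms (n i) := fun i => cone_eq_nonnegForms (hind i).1
    have hpos : 1 ≤ ∑ i, n i :=
      (hind 0).1.trans_le (Finset.single_le_sum (f := n) (fun _ _ => Nat.zero_le _) (Finset.mem_univ 0))
    simp only [hcone] at hF ⊢
    rw [cone_eq_nonnegForms hpos]
    exact isExtremeRay_prod_iff r n F hF hind
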